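/- Definitions. All structures have domain $\omega$. An injection structure is a pair $(\omega,f)$ with $f:\omega\to\omega$ injective; it is computable (resp. punctual) if $f$ is computable (resp. primitive recursive). The orbit of $x$ is the set of all $y$ with $f^m(x)=f^n(y)$ for some $m,n\ge 0$; an infinite orbit is an $\omega$-chain if some element of it has no $f$-preimage, and a $\zeta$-chain otherwise. A total function is $\Delta^0_n$ (relative to an oracle) if its graph is. A computable structure $A$ is relatively $\Delta^0_n$-categorical if for every structure $B\cong A$ with domain $\omega$ there is an isomorphism from $A$ onto $B$ that is $\Delta^0_n$ relative to the atomic diagram of $B$. For total $f,g:\omega\to\omega$, write $f\le_{PR}g$ if $f$ is obtained by a primitive recursive scheme with oracle $g$; the induced degrees are the PR-degrees. Let $\mathrm{prcat}(A)$ be the set of all PR-degrees $\mathbf d$ such that for every punctual structure $B\cong A$ there is an isomorphism $h:A\to B$ with $h\le_{PR}\mathbf d$ and $h^{-1}\le_{PR}\mathbf d$. Let $\mathrm{cone}(\Delta^0_3)$ be the set of all PR-degrees $\mathbf d$ such that $g\le_{PR}\mathbf d$ for every total $\Delta^0_3$ function $g:\omega\to\omega$. Theorem. Let $A$ be a computable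 injection structure that is relatively $\Delta^0_3$-categorical but not relatively $\Delta^0_2$-categorical. Then $A$ has infinitely many $\omega$-chains and infinitely many $\zeta$-chains, and $\mathrm{prcat}(A)=\mathrm{cone}(\Delta^0_3)$. -/

import Mathlib

namespace PunctualInj

/-! Structures with domain `ω` and one unary function are given by that function `A : ℕ → ℕ`;
injection structures are those with `A` injective. -/

/-- `PRIn g f`: the total function `f` is obtained from the oracle `g` by a primitive recursive
scheme, i.e. `f` lies in the least class that contains `g` and the initial functions and is closed
under pairing, composition and primitive recursion. These are the clauses of `Nat.Primrec`
together with a clause for the oracle. -/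
inductive PRIn (g : ℕ → ℕ) : (ℕ → ℕ) → Prop
  | oracle : PRIn g g
  | zero : PRIn g fun _ => 0
  | succ : PRIn g Nat.succ
  | left : PRIn g fun n => n.unpair.1
  | right : PRIn g fun n => n.unpair.2
  | pair {f h : ℕ → ℕ} : PRIn g f → PRIn g h → PRIn g fun n => Nat.pair (f n) (h n)
  | comp {f h : ℕ → ℕ} : PRIn g f → PRIn g h → PRIn g fun n => f (h n)
  | prec {f h : ℕ → ℕ} : PRIn g f → PRIn g h →
      PRIn g (Nat.unpaired fun z n =>
        n.rec (f z) fun y IH => h (Nat.pair z (Nat.pair y IH)))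

theorem PRIn.trans {f g k : ℕ → ℕ} (hfg : PRIn g f) (hgk : PRIn k g) : PRIn k f := by
  induction hfg with
  | oracle => exact hgk
  | zero => exact .zero
  | succ => exact .succ
  | left => exact .left
  | right => exact .right
  | pair _ _ h₁ h₂ => exact .pair h₁ h₂
  | comp _ _ h₁ h₂ => exact .comp h₁ h₂
  | prec _ _ h₁ h₂ => exact .prec h₁ h₂

/-- Mutual primitive recursive reducibility of total functions. -/
def prSetoid : Setoid (ℕ → ℕ) where
  r f g := PRIn g f ∧ PRIn f g
  iseqv :=
    { refl := fun _ => ⟨.oracle, .oracle⟩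
      symm := fun h => ⟨h.2, h.1⟩
      trans := fun h₁ h₂ => ⟨h₁.1.trans h₂.1, h₂.2.trans h₁.2⟩ }

/-- The PR-degrees: total functions modulo mutual primitive recursive reducibility. -/
def PRDegree : Type := Quotient prSetoid

/-- The PR-degree of a total function. -/
def prDeg (f : ℕ → ℕ) : PRDegree := Quotient.mk prSetoid f

/-- The order on PR-degrees induced by primitive recursive reducibility. -/
instance : LE PRDegree where
  le := Quotient.lift₂ (fun f g => PRIn g f) (by
    intro f g f' g' hf hg
    exact propext ⟨fun h => (hf.2.trans h).trans hg.1, fun h => (hf.1.trans h).trans hg.2⟩)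

theorem prDeg_le_prDeg {f g : ℕ → ℕ} : prDeg f ≤ prDeg g ↔ PRIn g f := Iff.rfl

/-- `SigmaIn O n S`: the set `S` is `Σ⁰ₙ` relative to the oracles in `O`. For `n = 0` this means
that the characteristic function of `S` is computable from `O`; a `Σ⁰ₙ₊₁` set is the projection of
the complement of a `Σ⁰ₙ` set of coded pairs. -/
def SigmaIn (O : Set (ℕ →. ℕ)) : ℕ → Set ℕ → Prop
  | 0, S => Nat.RecursiveIn O ((S.indicator 1 : ℕ → ℕ) : ℕ →. ℕ)
  | n + 1, S => ∃ R : Set ℕ, SigmaIn O n Rᶜ ∧ ∀ x, x ∈ S ↔ ∃ y, Nat.pair x y ∈ R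

/-- `S` is `Δ⁰ₙ` relative to `O`: both `S` and its complement are `Σ⁰ₙ` relative to `O`. -/
def DeltaIn (O : Set (ℕ →. ℕ)) (n : ℕ) (S : Set ℕ) : Prop :=
  SigmaIn O n S ∧ SigmaIn O n Sᶜ

/-- The total function `f` is `Δ⁰ₙ` relative to `O`: its (coded) graph is. -/
def DeltaFunIn (O : Set (ℕ →. ℕ)) (n : ℕ) (f : ℕ → ℕ) : Prop :=
  DeltaIn O n {p | f p.unpair.1 = p.unpair.2}

/-- `h` is an isomorphism from `(ω, A)` onto `(ω, B)`. -/
def IsIso (A B : ℕ → ℕ) (h : ℕ ≃ ℕ) : Prop := ∀ x, h (A x) = B (h x)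

/-- `(ω, A)` and `(ω, B)` are isomorphic. -/
def Isomorphic (A B : ℕ → ℕ) : Prop := ∃ h : ℕ ≃ ℕ, IsIso A B h

/-- The computable structure `(ω, A)` is relatively `Δ⁰ₙ`-categorical: every copy `(ω, B)`, of
arbitrary complexity, admits an isomorphism from `(ω, A)` which is `Δ⁰ₙ` relative to `B`
(the function `B` is Turing equivalent to the atomic diagram of `(ω, B)`). -/
def RelCategorical (n : ℕ) (A : ℕ → ℕ) : Prop :=
  ∀ B : ℕ → ℕ, Isomorphic A B →
    ∃ h : ℕ ≃ ℕ, IsIso A B h ∧ DeltaFunIn {(B : ℕ →. ℕ)} n h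

/-- The primitive recursive categoricity spectrum of `(ω, A)`: the PR-degrees `d` such that for
every punctual structure `(ω, B)` isomorphic to `(ω, A)` there is an isomorphism `h` from `(ω, A)`
onto `(ω, B)` with `h ≤ d` and `h⁻¹ ≤ d`. -/
def prcat (A : ℕ → ℕ) : Set PRDegree :=
  {d | ∀ B : ℕ → ℕ, Nat.Primrec B → Isomorphic A B →
    ∃ h : ℕ ≃ ℕ, IsIso A B h ∧ prDeg h ≤ d ∧ prDeg h.symm ≤ d}

/-- `cone n`: the PR-degrees that lie above every total (unrelativized) `Δ⁰ₙ` function. -/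
def cone (n : ℕ) : Set PRDegree :=
  {d | ∀ g : ℕ → ℕ, DeltaFunIn ∅ n g → prDeg g ≤ d}

/-- The orbit of `x`: the elements that have a common forward iterate with `x`. -/
def orbit (A : ℕ → ℕ) (x : ℕ) : Set ℕ := {y | ∃ m n : ℕ, A^[m] x = A^[n] y}

/-- The set of `ω`-chains: infinite orbits with an element that has no preimage. -/
def omegaChains (A : ℕ → ℕ) : Set (Set ℕ) :=
  {C | (∃ x, C = orbit A x) ∧ C.Infinite ∧ ∃ y ∈ C, y ∉ Set.range A}

/-- The set of `ζ`-chains: infinite orbits all of whose elements have a preimage. -/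
def zetaChains (A : ℕ → ℕ) : Set (Set ℕ) :=
  {C | (∃ x, C = orbit A x) ∧ C.Infinite ∧ C ⊆ Set.range A}

end PunctualInj

/-! Suppose that `A` had only finitely many ω-chains or only finitely many ζ-chains. Then membership
in an ω-chain is limit decidable in every copy `B`: fix one point in each of these finitely many
orbits and ask which points are connected to them. Connectedness and periods are limit computable
anyway, so matching the k-th orbit of each type in `A` with the k-th one in `B` yields an
isomorphism that is Δ⁰₂ in `B` (`relCategorical_two`). Hence failure of relative Δ⁰₂-categoricity
forces infinitely many chains of both kinds.

For punctual `B`, an isomorphism that is Δ⁰₃ in `B` is plainly Δ⁰₃, and so is its inverse. This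
gives one inclusion (`cone_subset_prcat`).

For the other one (`prcat_subset_cone`), let `g` be Δ⁰₃. From a primitive recursive relation `f`,
`colStr` builds a punctual structure that copies the finite orbits of `A`, has an ω-chain in each
even column, and in column `2a + 1` has a ζ-chain if `f a i` holds for infinitely many `i`, and an
ω-chain otherwise. It is isomorphic to `A` as soon as infinitely many `a` qualify
(`Staging.isomorphic_colStr`), and every Π⁰₂ property of `a` can be expressed in this way
(`infinite_progresses_iff`). The property used is `IsCode`: each `n` has exactly one code, which
contains the truth values of enough Π⁰₂ statements to determine `g` below `n`. An isomorphism from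
the copy whose odd columns are all ζ-chains to the copy in which only the codes give ζ-chains
produces an injective sequence of codes. Among any `n + 2` distinct codes, one belongs to a number
above `n`, so `g n` is found by a bounded search. -/

open Filter

namespace PunctualInj

/-! ### Classes of functions closed under primitive recursion -/

open scoped Classical in
/-- The characteristic function of a predicate. -/
noncomputable def ind (P : ℕ → Prop) : ℕ → ℕ := fun n => if P n then 1 else 0

theorem ind_pos {P : ℕ → Prop} {n : ℕ} (h : P n) : ind P n = 1 := if_pos h

theorem ind_neg {P : ℕ → Prop} {n : ℕ} (h : ¬P n) : ind P n = 0 := if_neg h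

theorem ind_eq_one {P : ℕ → Prop} {n : ℕ} : ind P n = 1 ↔ P n := by
  by_cases h : P n <;> simp [ind, h]

theorem ind_eq_zero {P : ℕ → Prop} {n : ℕ} : ind P n = 0 ↔ ¬P n := by
  by_cases h : P n <;> simp [ind, h]

theorem ind_congr {P Q : ℕ → Prop} (h : ∀ n, P n ↔ Q n) : ind P = ind Q := by
  have : P = Q := funext fun n => propext (h n)
  rw [this]

/-- A class of total functions that contains the initial functions and is closed under pairing,
composition and primitive recursion. -/
structure PRClosed (K : (ℕ → ℕ) → Prop) : Prop where
  zero : K fun _ => 0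
  succ : K Nat.succ
  left : K fun n => n.unpair.1
  right : K fun n => n.unpair.2
  pair {f h : ℕ → ℕ} : K f → K h → K fun n => Nat.pair (f n) (h n)
  comp {f h : ℕ → ℕ} : K f → K h → K fun n => f (h n)
  prec {f h : ℕ → ℕ} : K f → K h →
    K (Nat.unpaired fun z n => n.rec (f z) fun y IH => h (Nat.pair z (Nat.pair y IH)))

theorem PRIn.closed (g : ℕ → ℕ) : PRClosed (PRIn g) :=
  ⟨.zero, .succ, .left, .right, .pair, .comp, .prec⟩

/-- A predicate is decided by the class `K` if its characteristic function is in `K`. -/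
def Dec (K : (ℕ → ℕ) → Prop) (P : ℕ → Prop) : Prop := K (ind P)

theorem Dec.congr {K : (ℕ → ℕ) → Prop} {P Q : ℕ → Prop} (hP : Dec K P) (h : ∀ n, P n ↔ Q n) :
    Dec K Q := by
  unfold Dec at *
  rwa [← ind_congr h]

namespace PRClosed

variable {K : (ℕ → ℕ) → Prop}

theorem of_natPrimrec (hK : PRClosed K) {f : ℕ → ℕ} (hf : Nat.Primrec f) : K f := by
  induction hf with
  | zero => exact hK.zero
  | succ => exact hK.succ
  | left => exact hK.left
  | right => exact hK.right
  | pair _ _ h₁ h₂ => exact hK.pair h₁ h₂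
  | comp _ _ h₁ h₂ => exact hK.comp h₁ h₂
  | prec _ _ h₁ h₂ => exact hK.prec h₁ h₂

theorem of_primrec (hK : PRClosed K) {f : ℕ → ℕ} (hf : Primrec f) : K f :=
  hK.of_natPrimrec (Primrec.nat_iff.1 hf)

theorem id (hK : PRClosed K) : K fun n => n := hK.of_primrec Primrec.id

theorem const (hK : PRClosed K) (c : ℕ) : K fun _ => c := hK.of_primrec (Primrec.const c)

theorem comp₂ (hK : PRClosed K) {g : ℕ → ℕ → ℕ} {f h : ℕ → ℕ} (hg : Primrec₂ g) (hf : K f)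
    (hh : K h) : K fun n => g (f n) (h n) := by
  have : K fun p => g p.unpair.1 p.unpair.2 := hK.of_natPrimrec (Primrec₂.unpaired'.2 hg)
  simpa using hK.comp this (hK.pair hf hh)

theorem natRec (hK : PRClosed K) {f c : ℕ → ℕ} {h : ℕ → ℕ → ℕ → ℕ} (hf : K f)
    (hh : K fun p => h p.unpair.1 p.unpair.2.unpair.1 p.unpair.2.unpair.2) (hc : K c) :
    K fun n => Nat.rec (f n) (fun y ih => h n y ih) (c n) := by
  simpa [Nat.unpaired] using hK.comp (hK.prec hf hh) (hK.pair hK.id hc)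

theorem iterate (hK : PRClosed K) {f c x : ℕ → ℕ} (hf : K f) (hc : K c) (hx : K x) :
    K fun n => f^[c n] (x n) := by
  have := hK.natRec (f := x) (c := c) (h := fun _ _ ih => f ih) hx
    (hK.comp hf (hK.comp hK.right hK.right)) hc
  convert this using 2 with n
  generalize c n = k
  induction k with
  | zero => rfl
  | succ k ih => rw [Function.iterate_succ_apply', ih]

theorem ind_ite (hK : PRClosed K) {P : ℕ → Prop} {f g : ℕ → ℕ} [DecidablePred P] (hP : Dec K P)
    (hf : K f) (hg : K g) : K fun n => if P n then f n else g n := by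
  have h : Primrec₂ fun a p : ℕ => if a = 1 then p.unpair.1 else p.unpair.2 :=
    Primrec.ite (Primrec.eq.comp Primrec.fst (Primrec.const 1))
      (Primrec.fst.comp (Primrec.unpair.comp Primrec.snd))
      (Primrec.snd.comp (Primrec.unpair.comp Primrec.snd))
  have := hK.comp₂ h hP (hK.pair hf hg)
  simpa [ind_eq_one] using this

theorem dec_comp (hK : PRClosed K) {P : ℕ → Prop} {f : ℕ → ℕ} (hP : Dec K P) (hf : K f) :
    Dec K fun n => P (f n) := hK.comp (f := ind P) hP hf

theorem dec_comp₂ (hK : PRClosed K) {P : ℕ → ℕ → Prop} {f g : ℕ → ℕ}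
    (hP : Dec K fun p => P p.unpair.1 p.unpair.2) (hf : K f) (hg : K g) :
    Dec K fun n => P (f n) (g n) :=
  (hK.dec_comp hP (hK.pair hf hg)).congr fun n => by simp

theorem dec_not (hK : PRClosed K) {P : ℕ → Prop} (hP : Dec K P) : Dec K fun n => ¬P n := by
  classical
  have := hK.ind_ite hP (hK.const 0) (hK.const 1)
  unfold Dec
  convert this using 2 with n
  by_cases h : P n <;> simp [ind, h]

theorem dec_and (hK : PRClosed K) {P Q : ℕ → Prop} (hP : Dec K P) (hQ : Dec K Q) :
    Dec K fun n => P n ∧ Q n := by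
  classical
  have := hK.ind_ite hP hQ (hK.const 0)
  unfold Dec
  convert this using 2 with n
  by_cases h : P n <;> simp [ind, h]

theorem dec_or (hK : PRClosed K) {P Q : ℕ → Prop} (hP : Dec K P) (hQ : Dec K Q) :
    Dec K fun n => P n ∨ Q n :=
  (hK.dec_not (hK.dec_and (hK.dec_not hP) (hK.dec_not hQ))).congr fun n => by tauto

theorem dec_imp (hK : PRClosed K) {P Q : ℕ → Prop} (hP : Dec K P) (hQ : Dec K Q) :
    Dec K fun n => P n → Q n :=
  (hK.dec_or (hK.dec_not hP) hQ).congr fun n => by tauto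

theorem dec_primrecRel (hK : PRClosed K) {R : ℕ → ℕ → Prop} {f g : ℕ → ℕ} (hR : PrimrecRel R)
    (hf : K f) (hg : K g) : Dec K fun n => R (f n) (g n) := by
  classical
  have : Primrec₂ fun a b => if R a b then 1 else 0 :=
    Primrec.ite hR (Primrec.const 1) (Primrec.const 0)
  unfold Dec
  convert hK.comp₂ this hf hg using 2 with n
  by_cases h : R (f n) (g n) <;> simp [ind, h]

theorem dec_eq (hK : PRClosed K) {f g : ℕ → ℕ} (hf : K f) (hg : K g) :
    Dec K fun n => f n = g n := hK.dec_primrecRel Primrec.eq hf hg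

theorem dec_le (hK : PRClosed K) {f g : ℕ → ℕ} (hf : K f) (hg : K g) :
    Dec K fun n => f n ≤ g n := hK.dec_primrecRel Primrec.nat_le hf hg

theorem dec_const (hK : PRClosed K) (p : Prop) : Dec K fun _ => p := by
  by_cases h : p
  · exact (hK.dec_eq hK.zero hK.zero).congr fun n => by simp [h]
  · exact (hK.dec_eq hK.zero (hK.const 1)).congr fun n => by simp [h]

open scoped Classical in
theorem count (hK : PRClosed K) {P : ℕ → ℕ → Prop} {c : ℕ → ℕ}
    (hP : Dec K fun p => P p.unpair.1 p.unpair.2) (hc : K c) :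
    K fun n => Nat.count (P n) (c n) := by
  have h₁ : K fun p => p.unpair.2.unpair.2 + ind (fun p => P p.unpair.1 p.unpair.2)
      (Nat.pair p.unpair.1 p.unpair.2.unpair.1) :=
    hK.comp₂ Primrec.nat_add (hK.comp hK.right hK.right)
      (hK.comp hP (hK.pair hK.left (hK.comp hK.left hK.right)))
  have := hK.natRec (h := fun n y ih => ih + ind (fun p => P p.unpair.1 p.unpair.2) (Nat.pair n y))
    hK.zero h₁ hc
  convert this using 2 with n
  generalize c n = k
  induction k with
  | zero => simp
  | succ k ih =>
    rw [Nat.count_succ, ih]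
    simp [ind]

theorem dec_exists_lt (hK : PRClosed K) {P : ℕ → ℕ → Prop} {c : ℕ → ℕ}
    (hP : Dec K fun p => P p.unpair.1 p.unpair.2) (hc : K c) :
    Dec K fun n => ∃ i < c n, P n i := by
  classical
  refine (hK.dec_not (hK.dec_eq (hK.count hP hc) hK.zero)).congr fun n => ?_
  rw [Nat.count_iff_forall_not]
  push Not
  rfl

theorem dec_forall_lt (hK : PRClosed K) {P : ℕ → ℕ → Prop} {c : ℕ → ℕ}
    (hP : Dec K fun p => P p.unpair.1 p.unpair.2) (hc : K c) :
    Dec K fun n => ∀ i < c n, P n i :=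
  (hK.dec_not (hK.dec_exists_lt (P := fun n i => ¬P n i) (hK.dec_not hP) hc)).congr fun n => by
    push Not
    rfl

end PRClosed

open scoped Classical in
/-- The least `i < c` with `P i`, and `c` if there is none. -/
noncomputable def bfind (P : ℕ → Prop) (c : ℕ) : ℕ := Nat.count (fun i => ∀ j < i + 1, ¬P j) c

theorem bfind_eq {P : ℕ → Prop} {c i : ℕ} (hi : i < c) (hP : P i) (hlt : ∀ j < i, ¬P j) :
    bfind P c = i := by
  classical
  obtain ⟨d, rfl⟩ := Nat.exists_eq_add_of_le hi.le
  unfold bfind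
  rw [Nat.count_add, (Nat.count_iff_forall).2, Nat.add_eq_left, Nat.count_iff_forall_not]
  · intro j _ h
    exact h i (by omega) hP
  · intro j hj k hk
    exact hlt k (by omega)

theorem bfind_of_not {P : ℕ → Prop} {c : ℕ} (h : ∀ j < c, ¬P j) : bfind P c = c := by
  classical
  exact Nat.count_iff_forall.2 fun j hj k hk => h k (by omega)

theorem PRClosed.bfind {K : (ℕ → ℕ) → Prop} (hK : PRClosed K) {P : ℕ → ℕ → Prop} {c : ℕ → ℕ}
    (hP : Dec K fun p => P p.unpair.1 p.unpair.2) (hc : K c) :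
    K fun n => bfind (P n) (c n) := by
  classical
  have : Dec K fun p => ∀ j < p.unpair.2 + 1, ¬P p.unpair.1 j := by
    refine hK.dec_forall_lt (P := fun p j => ¬P p.unpair.1 j) (hK.dec_not ?_)
      (hK.comp hK.succ hK.right)
    exact hK.dec_comp₂ hP (hK.comp hK.left hK.left) hK.right
  convert hK.count (P := fun n i => ∀ j < i + 1, ¬P n j) this hc using 2 with n
  unfold PunctualInj.bfind
  congr

/-! ### Limit computability -/

/-- Pointwise limits of functions in the class `K`. -/
def Lim (K : (ℕ → ℕ) → Prop) (F : ℕ → ℕ) : Prop :=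
  ∃ G, K G ∧ ∀ x, ∀ᶠ s in atTop, G (Nat.pair x s) = F x

namespace Lim

variable {K : (ℕ → ℕ) → Prop}

theorem of_mem (hK : PRClosed K) {F : ℕ → ℕ} (hF : K F) : Lim K F :=
  ⟨fun p => F p.unpair.1, hK.comp hF hK.left, fun x => by simp⟩

/-- Evaluate all approximations at one common stage. A value depends on finitely many values of the
approximated functions, and these are all final from some stage on. -/
theorem closed (hK : PRClosed K) : PRClosed (Lim K) where
  zero := of_mem hK hK.zero
  succ := of_mem hK hK.succ
  left := of_mem hK hK.left
  right := of_mem hK hK.right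
  pair := by
    rintro f h ⟨F, hF, lF⟩ ⟨H, hH, lH⟩
    refine ⟨_, hK.pair hF hH, fun x => ?_⟩
    filter_upwards [lF x, lH x] with s h₁ h₂
    rw [h₁, h₂]
  comp := by
    rintro f h ⟨F, hF, lF⟩ ⟨H, hH, lH⟩
    refine ⟨fun p => F (Nat.pair (H p) p.unpair.2), hK.comp hF (hK.pair hH hK.right), fun x => ?_⟩
    filter_upwards [lF (h x), lH x] with s h₁ h₂
    simp [h₁, h₂]
  prec := by
    rintro f h ⟨F, hF, lF⟩ ⟨H, hH, lH⟩
    have hs : K fun p => p.unpair.1.unpair.2 := hK.comp hK.right hK.left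
    have hz : K fun p => p.unpair.1.unpair.1.unpair.1 :=
      hK.comp hK.left (hK.comp hK.left hK.left)
    refine ⟨fun p => Nat.rec (F (Nat.pair p.unpair.1.unpair.1 p.unpair.2))
      (fun y ih => H (Nat.pair (Nat.pair p.unpair.1.unpair.1 (Nat.pair y ih)) p.unpair.2))
      p.unpair.1.unpair.2, hK.natRec (h := fun p y ih =>
        H (Nat.pair (Nat.pair p.unpair.1.unpair.1 (Nat.pair y ih)) p.unpair.2)) ?_ ?_ ?_,
      fun x => ?_⟩
    · exact hK.comp hF (hK.pair (hK.comp hK.left hK.left) hK.right)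
    · exact hK.comp hH (hK.pair (hK.pair hz hK.right |> fun h => by simpa using h) hs)
    · exact hK.comp hK.right hK.left
    · simp only [Nat.unpair_pair, Nat.unpaired]
      generalize x.unpair.2 = n
      generalize x.unpair.1 = z
      induction n with
      | zero => exact lF z
      | succ n ih =>
        filter_upwards [ih, lH (Nat.pair z (Nat.pair n (Nat.rec (f z)
          (fun y IH => h (Nat.pair z (Nat.pair y IH))) n)))] with s h₁ h₂
        simp only [h₁, h₂]

theorem dec_exists (hK : PRClosed K) {P : ℕ → ℕ → Prop}
    (hP : Dec K fun p => P p.unpair.1 p.unpair.2) : Dec (Lim K) fun n => ∃ w, P n w := by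
  have h : Dec K fun p => ∃ w < p.unpair.2, P p.unpair.1 w :=
    hK.dec_exists_lt (P := fun p w => P p.unpair.1 w)
      (hK.dec_comp₂ hP (hK.comp hK.left hK.left) hK.right) hK.right
  refine ⟨_, h, fun x => ?_⟩
  by_cases hx : ∃ w, P x w
  · obtain ⟨w, hw⟩ := hx
    filter_upwards [eventually_gt_atTop w] with s hs
    rw [ind_pos, ind_pos ⟨w, hw⟩]
    simp only [Nat.unpair_pair]
    exact ⟨w, hs, hw⟩
  · refine Eventually.of_forall fun s => ?_
    rw [ind_neg (P := fun n => ∃ w, P n w) hx, ind_neg]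
    rintro ⟨w, -, hw⟩
    simp only [Nat.unpair_pair] at hw
    exact hx ⟨w, hw⟩

/-- An unbounded search costs no further limit: at stage `s`, search below `s` with the guesses of
stage `s`. The answer is `F x` once `s > F x` and the finitely many guesses for `y ≤ F x` are final.
-/
theorem find (hK : PRClosed K) {P : ℕ → ℕ → Prop} {F : ℕ → ℕ}
    (hP : Dec (Lim K) fun p => P p.unpair.1 p.unpair.2) (hF : ∀ x, P x (F x))
    (hlt : ∀ x, ∀ y < F x, ¬P x y) : Lim K F := by
  obtain ⟨G, hG, lG⟩ := hP
  refine ⟨fun p => bfind (fun y => G (Nat.pair (Nat.pair p.unpair.1 y) p.unpair.2) = 1)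
    p.unpair.2, ?_, fun x => ?_⟩
  · refine hK.bfind (P := fun p y => G (Nat.pair (Nat.pair p.unpair.1 y) p.unpair.2) = 1) ?_
      hK.right
    exact hK.dec_eq (hK.comp hG (hK.pair (hK.pair (hK.comp hK.left hK.left) hK.right)
      (hK.comp hK.right hK.left))) (hK.const 1)
  · have h₁ : ∀ᶠ s in atTop, ∀ y ∈ Set.Iic (F x), G (Nat.pair (Nat.pair x y) s) =
        ind (fun p => P p.unpair.1 p.unpair.2) (Nat.pair x y) :=
      ((Set.finite_Iic (F x)).eventually_all).2 fun y _ => lG _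
    filter_upwards [h₁, eventually_gt_atTop (F x)] with s h₁ h₂
    simp only [Nat.unpair_pair]
    refine bfind_eq h₂ ?_ fun j hj => ?_
    · rw [h₁ _ (Set.mem_Iic.2 le_rfl), ind_eq_one]
      simpa using hF x
    · rw [h₁ _ (Set.mem_Iic.2 hj.le), ind_eq_one]
      simpa using hlt x j hj

theorem exists_find (hK : PRClosed K) {P : ℕ → ℕ → Prop}
    (hP : Dec (Lim K) fun p => P p.unpair.1 p.unpair.2) (hex : ∀ x, ∃ y, P x y) :
    ∃ F, Lim K F ∧ ∀ x, P x (F x) := by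
  classical
  exact ⟨fun x => Nat.find (hex x), find hK hP (fun x => Nat.find_spec (hex x))
    (fun x y hy => Nat.find_min (hex x) hy), fun x => Nat.find_spec (hex x)⟩

end Lim

/-! ### From limits to Δ⁰₂ graphs -/

/-- The total functions computable from the oracles in `O`. -/
def RecIn (O : Set (ℕ →. ℕ)) (G : ℕ → ℕ) : Prop := Nat.RecursiveIn O (G : ℕ →. ℕ)

theorem RecIn.closed (O : Set (ℕ →. ℕ)) : PRClosed (RecIn O) where
  zero := .zero
  succ := .succ
  left := .left
  right := .right
  pair h₁ h₂ := (Nat.RecursiveIn.pair h₁ h₂).of_eq fun n => by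
    simp [Seq.seq]
  comp h₁ h₂ := (Nat.RecursiveIn.comp h₁ h₂).of_eq fun _ => Part.bind_some _ _
  prec {f h} h₁ h₂ := (Nat.RecursiveIn.prec h₁ h₂).of_eq fun n => by
    simp only [Nat.unpaired, PFun.coe_val]
    generalize n.unpair.2 = k
    induction k with
    | zero => rfl
    | succ k ih => exact (congrArg (fun z => z >>= _) ih).trans (by simp [Bind.bind])

theorem sigmaIn_one {O : Set (ℕ →. ℕ)} {P : ℕ → ℕ → Prop}
    (hP : Dec (RecIn O) fun p => P p.unpair.1 p.unpair.2) : SigmaIn O 1 {x | ∃ y, P x y} := by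
  refine ⟨{p | P p.unpair.1 p.unpair.2}, ?_, fun x => by simp⟩
  have := (RecIn.closed O).dec_not hP
  unfold SigmaIn
  unfold Dec RecIn at this
  convert this using 2
  ext n
  by_cases h : P n.unpair.1 n.unpair.2 <;> simp [ind, h]

theorem sigmaIn_two {O : Set (ℕ →. ℕ)} {P : ℕ → ℕ → ℕ → Prop}
    (hP : Dec (RecIn O) fun p => P p.unpair.1.unpair.1 p.unpair.1.unpair.2 p.unpair.2) :
    SigmaIn O 2 {x | ∃ y, ∀ z, P x y z} := by
  refine ⟨{q | ∀ z, P q.unpair.1 q.unpair.2 z}, ?_, fun x => by simp⟩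
  have := sigmaIn_one (P := fun q z => ¬P q.unpair.1 q.unpair.2 z) ((RecIn.closed O).dec_not hP)
  convert this using 1
  ext q
  simp

/-- The easy half of the limit lemma: `h x = y` and its negation each say that the approximation
eventually behaves accordingly, which is an `∃∀` statement. -/
theorem Lim.deltaFunIn {O : Set (ℕ →. ℕ)} {h : ℕ → ℕ} (hh : Lim (RecIn O) h) :
    DeltaFunIn O 2 h := by
  obtain ⟨G, hG, lG⟩ := hh
  have hK := RecIn.closed O
  have hd : Dec (RecIn O) fun p =>
      G (Nat.pair p.unpair.1.unpair.1.unpair.1 p.unpair.2) = p.unpair.1.unpair.1.unpair.2 :=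
    hK.dec_eq (hK.comp hG (hK.pair (hK.comp hK.left (hK.comp hK.left hK.left)) hK.right))
      (hK.comp hK.right (hK.comp hK.left hK.left))
  have hle : Dec (RecIn O) fun p => p.unpair.1.unpair.2 ≤ p.unpair.2 :=
    hK.dec_le (hK.comp hK.right hK.left) hK.right
  have key : ∀ (x y : ℕ) (Q : ℕ → Prop), (∃ s, ∀ t, s ≤ t → Q (G (Nat.pair x t))) ↔ Q (h x) := by
    intro x y Q
    rw [← eventually_atTop]
    exact (eventually_congr ((lG x).mono fun s hs => by rw [hs])).trans eventually_const
  constructor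
  · convert sigmaIn_two (P := fun x s t => s ≤ t →
      G (Nat.pair x.unpair.1 t) = x.unpair.2) (hK.dec_imp hle hd) using 1
    ext p
    exact (key _ p (· = p.unpair.2)).symm
  · convert sigmaIn_two (P := fun x s t => s ≤ t →
      ¬G (Nat.pair x.unpair.1 t) = x.unpair.2) (hK.dec_imp hle (hK.dec_not hd)) using 1
    ext p
    exact (key _ p (¬· = p.unpair.2)).symm

/-! ### Orbits, canonical elements and orbit types -/

/-- Two points are connected if they have a common forward iterate. -/
def Conn (A : ℕ → ℕ) (x y : ℕ) : Prop := ∃ m n : ℕ, A^[m] x = A^[n] y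

namespace Conn

variable {A : ℕ → ℕ} {x y z : ℕ}

theorem refl (A : ℕ → ℕ) (x : ℕ) : Conn A x x := ⟨0, 0, rfl⟩

theorem symm (h : Conn A x y) : Conn A y x := by
  obtain ⟨m, n, h⟩ := h
  exact ⟨n, m, h.symm⟩

theorem trans (h₁ : Conn A x y) (h₂ : Conn A y z) : Conn A x z := by
  obtain ⟨m, n, h⟩ := h₁
  obtain ⟨k, l, h'⟩ := h₂
  refine ⟨k + m, n + l, ?_⟩
  rw [Function.iterate_add_apply, h, ← Function.iterate_add_apply, add_comm k n,
    Function.iterate_add_apply, h', ← Function.iterate_add_apply]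

theorem apply (A : ℕ → ℕ) (x : ℕ) : Conn A (A x) x := ⟨0, 1, rfl⟩

end Conn

/-- The orbit of `x` contains a point without preimage. -/
def IsOm (A : ℕ → ℕ) (x : ℕ) : Prop := ∃ r, Conn A r x ∧ r ∉ Set.range A

/-- A canonical element of the orbit of `x`: the root of an `ω`-chain, and the least element of
any other orbit. -/
noncomputable def base (A : ℕ → ℕ) (x : ℕ) : ℕ :=
  sInf {b | Conn A b x ∧ (IsOm A x → b ∉ Set.range A)}

/-- The isomorphism type of the orbit of `x`. -/
noncomputable def typ (A : ℕ → ℕ) (x : ℕ) : ℕ :=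
  Nat.pair (ind (IsOm A) x) (Function.minimalPeriod A x)

variable {A B : ℕ → ℕ} {x y b b' : ℕ}

theorem Conn.isOm_iff (h : Conn A x y) : IsOm A x ↔ IsOm A y :=
  ⟨fun ⟨r, hr, hr'⟩ => ⟨r, hr.trans h, hr'⟩, fun ⟨r, hr, hr'⟩ => ⟨r, hr.trans h.symm, hr'⟩⟩

theorem Conn.base_eq (h : Conn A x y) : base A x = base A y := by
  unfold base
  congr 1
  ext b
  rw [Set.mem_ofPred_eq, Set.mem_ofPred_eq, h.isOm_iff]
  exact and_congr_left' ⟨fun h' => h'.trans h, fun h' => h'.trans h.symm⟩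

theorem base_spec (A : ℕ → ℕ) (x : ℕ) :
    Conn A (base A x) x ∧ (IsOm A x → base A x ∉ Set.range A) := by
  apply Nat.sInf_mem (s := {b | Conn A b x ∧ (IsOm A x → b ∉ Set.range A)})
  by_cases h : IsOm A x
  · obtain ⟨r, hr, hr'⟩ := h
    exact ⟨r, hr, fun _ => hr'⟩
  · exact ⟨x, .refl A x, fun h' => (h h').elim⟩

theorem base_base (A : ℕ → ℕ) (x : ℕ) : base A (base A x) = base A x := (base_spec A x).1.base_eq

theorem Conn.minimalPeriod_eq (hA : Function.Injective A) (h : Conn A x y) :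
    Function.minimalPeriod A x = Function.minimalPeriod A y := by
  have key : ∀ (m n : ℕ) (z : ℕ), Function.IsPeriodicPt A n (A^[m] z) ↔
      Function.IsPeriodicPt A n z := by
    intro m n z
    unfold Function.IsPeriodicPt Function.IsFixedPt
    rw [← Function.iterate_add_apply, add_comm, Function.iterate_add_apply]
    exact (hA.iterate m).eq_iff
  obtain ⟨m, n, h⟩ := h
  rw [Function.minimalPeriod_eq_minimalPeriod_iff]
  intro k
  rw [← key m k x, h, key n k y]

theorem typ_eq_iff : typ A x = typ B y ↔ (IsOm A x ↔ IsOm B y) ∧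
    Function.minimalPeriod A x = Function.minimalPeriod B y := by
  unfold typ
  rw [Nat.pair_eq_pair]
  refine and_congr_left fun _ => ?_
  by_cases h₁ : IsOm A x <;> by_cases h₂ : IsOm B y <;> simp [ind, h₁, h₂]

theorem Conn.typ_eq (hA : Function.Injective A) (h : Conn A x y) : typ A x = typ A y :=
  typ_eq_iff.2 ⟨h.isOm_iff, h.minimalPeriod_eq hA⟩

theorem typ_base (hA : Function.Injective A) (x : ℕ) : typ A (base A x) = typ A x :=
  (base_spec A x).1.typ_eq hA

theorem iterate_eq_iterate_iff (hA : Function.Injective A) (m k : ℕ) :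
    A^[m + k] x = A^[m] x ↔ Function.minimalPeriod A x ∣ k := by
  rw [← Function.isPeriodicPt_iff_minimalPeriod_dvd, Function.iterate_add_apply,
    (hA.iterate m).eq_iff]
  rfl

theorem not_isOm_of_isPeriodicPt (hA : Function.Injective A)
    (h : 0 < Function.minimalPeriod A x) : ¬IsOm A x := by
  rintro ⟨r, hr, hr'⟩
  rw [← hr.minimalPeriod_eq hA] at h
  refine hr' ⟨A^[Function.minimalPeriod A r - 1] r, ?_⟩
  rw [← Function.iterate_succ_apply' A, Nat.succ_eq_add_one, Nat.sub_add_cancel h]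
  exact Function.iterate_minimalPeriod

theorem mem_range_iterate_of_not_isOm (h : ¬IsOm A x) (n : ℕ) : ∃ z, A^[n] z = x := by
  induction n with
  | zero => exact ⟨x, rfl⟩
  | succ n ih =>
    obtain ⟨z, hz⟩ := ih
    by_contra hc
    refine h ⟨z, ⟨n, 0, hz⟩, ?_⟩
    rintro ⟨w, rfl⟩
    exact hc ⟨w, hz⟩

/-! ### The isomorphism that matches orbits in order -/

/-- The number of smaller canonical elements of the same type. -/
noncomputable def rank (A : ℕ → ℕ) (b : ℕ) : ℕ :=
  open scoped Classical in Nat.count (fun c => base A c = c ∧ typ A c = typ A b) b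

/-- The canonical elements `b` of `A` and `b'` of `B` correspond to each other. -/
def Match (A B : ℕ → ℕ) (b b' : ℕ) : Prop :=
  base A b = b ∧ base B b' = b' ∧ typ A b = typ B b' ∧ rank A b = rank B b'

theorem Match.symm (h : Match A B b b') : Match B A b' b :=
  ⟨h.2.1, h.1, h.2.2.1.symm, h.2.2.2.symm⟩

theorem Match.unique {b'' : ℕ} (h : Match A B b b') (h' : Match A B b b'') : b' = b'' := by
  classical
  have h₁ := h.2.2.2
  rw [h'.2.2.2] at h₁
  have ht : typ B b'' = typ B b' := h'.2.2.1.symm.trans h.2.2.1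
  unfold rank at h₁
  rw [ht] at h₁
  exact (Nat.count_injective ⟨h'.2.1, ht⟩ ⟨h.2.1, rfl⟩ h₁).symm

theorem Match.iterate_iff (hA : Function.Injective A) (hB : Function.Injective B)
    (h : Match A B b b') (m n : ℕ) : A^[m] b = A^[n] b ↔ B^[m] b' = B^[n] b' := by
  have hp := (typ_eq_iff.1 h.2.2.1).2
  rcases le_total m n with hl | hl <;> obtain ⟨k, rfl⟩ := Nat.exists_eq_add_of_le hl
  · rw [eq_comm, iterate_eq_iterate_iff hA, eq_comm (a := B^[m] b'), iterate_eq_iterate_iff hB, hp]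
  · rw [iterate_eq_iterate_iff hA, iterate_eq_iterate_iff hB, hp]

/-- Only points lying before the canonical element need an argument. An ω-chain has none, its
canonical element being the root. Hence the orbit of `b'` has no root either and can be followed
backwards arbitrarily far. -/
theorem Match.exists_iterate (hA : Function.Injective A)
    (h : Match A B b b') {m n : ℕ} (hx : A^[m] b = A^[n] x) : ∃ y, B^[m] b' = B^[n] y := by
  by_cases hnm : n ≤ m
  · obtain ⟨k, rfl⟩ := Nat.exists_eq_add_of_le hnm
    exact ⟨B^[k] b', Function.iterate_add_apply B n k b'⟩
  obtain ⟨k, rfl⟩ := Nat.exists_eq_add_of_lt (not_le.1 hnm)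
  have ho : ¬IsOm B b' := by
    rw [← (typ_eq_iff.1 h.2.2.1).1]
    intro hb
    have := (base_spec A b).2 hb
    rw [h.1] at this
    rw [add_assoc, Function.iterate_add_apply, (hA.iterate m).eq_iff,
      Function.iterate_succ_apply'] at hx
    exact this ⟨_, hx.symm⟩
  obtain ⟨z, hz⟩ := mem_range_iterate_of_not_isOm ho (k + 1)
  refine ⟨z, ?_⟩
  rw [add_assoc, Function.iterate_add_apply, hz]

theorem exists_match (hA : Function.Injective A)
    (hE : ∀ t, Nonempty ({b // base A b = b ∧ typ A b = t} ≃ {b // base B b = b ∧ typ B b = t}))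
    (x : ℕ) : ∃ b', Match A B (base A x) b' := by
  classical
  obtain ⟨e⟩ := hE (typ A x)
  set p : ℕ → Prop := fun b => base A b = b ∧ typ A b = typ A x
  set q : ℕ → Prop := fun b => base B b = b ∧ typ B b = typ A x
  have hp : p (base A x) := ⟨base_base A x, typ_base hA x⟩
  -- `Nat.nth` takes default values beyond the end of a finite set, so the rank has to be smaller
  -- than the number of canonical elements of this type in `B`, which is the same as in `A`.
  have hlt : ∀ hf : (Set.ofPred q).Finite, Nat.count p (base A x) < hf.toFinset.card := by
    intro hf
    have hf' : (Set.ofPred p).Finite := by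
      have : Finite {b // q b} := hf
      exact (Finite.of_equiv _ e.symm : Finite {b // p b})
    have hc : hf'.toFinset.card = hf.toFinset.card := by
      rw [← Set.ncard_eq_toFinset_card _ hf, ← Set.ncard_eq_toFinset_card _ hf']
      exact Nat.card_congr e
    rw [← hc]
    exact Nat.count_lt_card hf' hp
  have hq := Nat.nth_mem (p := q) (Nat.count p (base A x)) hlt
  refine ⟨Nat.nth q (Nat.count p (base A x)), hp.1, hq.1, hp.2.trans hq.2.symm, ?_⟩
  have h₁ : rank A (base A x) = Nat.count p (base A x) := by
    unfold rank
    rw [hp.2]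
  have h₂ : rank B (Nat.nth q (Nat.count p (base A x))) =
      Nat.count q (Nat.nth q (Nat.count p (base A x))) := by
    unfold rank
    rw [hq.2]
  rw [h₁, h₂, Nat.count_nth hlt]

/-- `y` sits in `B` at the same place relative to the canonical element of its orbit as `x` does
in `A`, and these canonical elements correspond to each other. -/
def Corr (A B : ℕ → ℕ) (x y : ℕ) : Prop :=
  ∃ b' m n : ℕ, Match A B (base A x) b' ∧ A^[m] (base A x) = A^[n] x ∧ B^[m] b' = B^[n] y

theorem Corr.symm (h : Corr A B x y) : Corr B A y x := by
  obtain ⟨b', m, n, hm, h₁, h₂⟩ := h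
  have hb : base B y = b' := by
    rw [← hm.2.1]
    exact (Conn.base_eq ⟨m, n, h₂⟩).symm
  exact ⟨base A x, m, n, hb ▸ hm.symm, hb ▸ h₂, h₁⟩

/-- The exponents chosen in `Corr` do not matter: coincidences among iterates of the canonical
element carry over to `B`, where iterates can be cancelled by injectivity. -/
theorem Corr.iterate_eq (hA : Function.Injective A) (hB : Function.Injective B)
    (h : Corr A B x y) (hm : Match A B (base A x) b') {m n : ℕ}
    (hx : A^[m] (base A x) = A^[n] x) : B^[m] b' = B^[n] y := by
  obtain ⟨b'', m₀, n₀, hm₀, h₁, h₂⟩ := h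
  obtain rfl := hm.unique hm₀
  have h₃ : A^[n + m₀] (base A x) = A^[n₀ + m] (base A x) := by
    rw [Function.iterate_add_apply, h₁, Function.iterate_add_apply A n₀, hx,
      ← Function.iterate_add_apply, ← Function.iterate_add_apply, add_comm]
  rw [hm.iterate_iff hA hB, Function.iterate_add_apply, h₂, Function.iterate_add_apply B n₀,
    ← Function.iterate_add_apply, add_comm, Function.iterate_add_apply] at h₃
  exact (hB.iterate n₀ h₃).symm

theorem Corr.unique {z : ℕ} (hA : Function.Injective A) (hB : Function.Injective B)
    (h : Corr A B x y) (h' : Corr A B x z) : y = z := by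
  obtain ⟨b', m, n, hm, h₁, h₂⟩ := h
  exact hB.iterate n (h₂.symm.trans (h'.iterate_eq hA hB hm h₁))

theorem Corr.apply (h : Corr A B x y) : Corr A B (A x) (B y) := by
  obtain ⟨b', m, n, hm, h₁, h₂⟩ := h
  have hb : base A (A x) = base A x := (Conn.apply A x).base_eq
  refine ⟨b', m + 1, n, by rwa [hb], ?_, ?_⟩
  · rw [hb, Function.iterate_succ_apply', h₁, ← Function.iterate_succ_apply' A,
      Function.iterate_succ_apply]
  · rw [Function.iterate_succ_apply', h₂, ← Function.iterate_succ_apply' B,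
      Function.iterate_succ_apply]

theorem exists_corr (hA : Function.Injective A)
    (hE : ∀ t, Nonempty ({b // base A b = b ∧ typ A b = t} ≃ {b // base B b = b ∧ typ B b = t}))
    (x : ℕ) : ∃ y, Corr A B x y := by
  obtain ⟨b', hb⟩ := exists_match hA hE x
  obtain ⟨m, n, h⟩ := (base_spec A x).1
  obtain ⟨y, hy⟩ := hb.exists_iterate hA h
  exact ⟨y, b', m, n, hb, h, hy⟩

/-- Injection structures with equally many orbits of each type are isomorphic. -/
theorem exists_isIso_corr (hA : Function.Injective A) (hB : Function.Injective B)
    (hE : ∀ t, Nonempty ({b // base A b = b ∧ typ A b = t} ≃ {b // base B b = b ∧ typ B b = t})) :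
    ∃ h : ℕ ≃ ℕ, IsIso A B h ∧ ∀ x, Corr A B x (h x) := by
  choose f hf using exists_corr hA hE
  choose g hg using exists_corr hB fun t => (hE t).map Equiv.symm
  exact ⟨⟨f, g, fun x => (hg _).unique hB hA (hf x).symm, fun y => (hf _).unique hA hB (hg y).symm⟩,
    fun x => (hf _).unique hA hB (hf x).apply, hf⟩

/-- The maps `u` and `v` need to be mutually inverse only up to connectedness; passing to canonical
elements turns them into bijections. -/
theorem nonempty_bases_equiv {t : ℕ} (hA : Function.Injective A) (hB : Function.Injective B)
    (u v : ℕ → ℕ)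
    (hu : ∀ x, typ A x = t → typ B (u x) = t) (hv : ∀ x, typ B x = t → typ A (v x) = t)
    (hu' : ∀ x y, typ A x = t → typ A y = t → Conn A x y → Conn B (u x) (u y))
    (hv' : ∀ x y, typ B x = t → typ B y = t → Conn B x y → Conn A (v x) (v y))
    (hvu : ∀ x, typ A x = t → Conn A (v (u x)) x) (huv : ∀ x, typ B x = t → Conn B (u (v x)) x) :
    Nonempty ({b // base A b = b ∧ typ A b = t} ≃ {b // base B b = b ∧ typ B b = t}) := by
  refine ⟨⟨fun b => ⟨base B (u b), base_base B _, ?_⟩, fun b => ⟨base A (v b), base_base A _, ?_⟩,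
    ?_, ?_⟩⟩
  · rw [typ_base hB, hu _ b.2.2]
  · rw [typ_base hA, hv _ b.2.2]
  · rintro ⟨b, hb, ht⟩
    refine Subtype.ext ?_
    have h₁ := hv' _ _ (by rw [typ_base hB, hu _ ht]) (hu _ ht) (base_spec B (u b)).1
    exact (h₁.trans (hvu b ht)).base_eq.trans hb
  · rintro ⟨b, hb, ht⟩
    refine Subtype.ext ?_
    have h₁ := hu' _ _ (by rw [typ_base hA, hv _ ht]) (hv _ ht) (base_spec A (v b)).1
    exact (h₁.trans (huv b ht)).base_eq.trans hb

/-! ### Invariance under isomorphism -/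

section Transport

variable {h : ℕ ≃ ℕ}

theorem IsIso.symm (hh : IsIso A B h) : IsIso B A h.symm := fun x => by
  rw [Equiv.symm_apply_eq, hh, Equiv.apply_symm_apply]

theorem IsIso.trans {C : ℕ → ℕ} {k : ℕ ≃ ℕ} (hh : IsIso A B h) (hk : IsIso B C k) :
    IsIso A C (h.trans k) := fun x => by
  rw [Equiv.trans_apply, hh, hk, Equiv.trans_apply]

theorem IsIso.iterate (hh : IsIso A B h) (n x : ℕ) : h (A^[n] x) = B^[n] (h x) :=
  (Function.Semiconj.iterate_right hh n) x

theorem IsIso.injective (hh : IsIso A B h) (hA : Function.Injective A) : Function.Injective B := by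
  intro x y hxy
  apply h.symm.injective
  apply hA
  rw [← hh.symm, ← hh.symm, hxy]

theorem IsIso.conn (hh : IsIso A B h) (hxy : Conn A x y) : Conn B (h x) (h y) := by
  obtain ⟨m, n, e⟩ := hxy
  exact ⟨m, n, by rw [← hh.iterate, ← hh.iterate, e]⟩

theorem IsIso.conn_iff (hh : IsIso A B h) : Conn B (h x) (h y) ↔ Conn A x y :=
  ⟨fun hc => by simpa using hh.symm.conn hc, hh.conn⟩

theorem IsIso.mem_range_iff (hh : IsIso A B h) : h x ∈ Set.range B ↔ x ∈ Set.range A := by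
  constructor
  · rintro ⟨y, hy⟩
    exact ⟨h.symm y, by rw [← hh.symm, hy, Equiv.symm_apply_apply]⟩
  · rintro ⟨y, rfl⟩
    exact ⟨h y, (hh y).symm⟩

theorem IsIso.isOm_iff (hh : IsIso A B h) : IsOm B (h x) ↔ IsOm A x := by
  constructor
  · rintro ⟨r, hr, hr'⟩
    refine ⟨h.symm r, hh.conn_iff.1 (by simpa using hr), ?_⟩
    rwa [← hh.mem_range_iff, Equiv.apply_symm_apply]
  · rintro ⟨r, hr, hr'⟩
    exact ⟨h r, hh.conn hr, by rwa [hh.mem_range_iff]⟩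

theorem IsIso.minimalPeriod_eq (hh : IsIso A B h) :
    Function.minimalPeriod B (h x) = Function.minimalPeriod A x := by
  rw [Function.minimalPeriod_eq_minimalPeriod_iff]
  intro n
  unfold Function.IsPeriodicPt Function.IsFixedPt
  rw [← hh.iterate, h.apply_eq_iff_eq]

theorem IsIso.typ_eq (hh : IsIso A B h) : typ B (h x) = typ A x :=
  typ_eq_iff.2 ⟨hh.isOm_iff, hh.minimalPeriod_eq⟩

theorem IsIso.nonempty_bases_equiv (hh : IsIso A B h) (hA : Function.Injective A) (t : ℕ) :
    Nonempty ({b // base A b = b ∧ typ A b = t} ≃ {b // base B b = b ∧ typ B b = t}) := by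
  refine PunctualInj.nonempty_bases_equiv hA (hh.injective hA) h h.symm ?_ ?_ ?_ ?_ ?_ ?_
  · exact fun x hx => hh.typ_eq.trans hx
  · exact fun x hx => hh.symm.typ_eq.trans hx
  · exact fun x y _ _ => hh.conn
  · exact fun x y _ _ => hh.symm.conn
  · exact fun x _ => by simpa using Conn.refl A x
  · exact fun x _ => by simpa using Conn.refl B x

end Transport

/-! ### Chains as orbit types -/

/-- The canonical elements of type `t`. -/
def basesOf (A : ℕ → ℕ) (t : ℕ) : Set ℕ := {b | base A b = b ∧ typ A b = t}

variable {A B X : ℕ → ℕ} {K : (ℕ → ℕ) → Prop}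

theorem minimalPeriod_eq_zero_of_isOm (hA : Function.Injective A) {x : ℕ} (h : IsOm A x) :
    Function.minimalPeriod A x = 0 := by
  by_contra hc
  exact not_isOm_of_isPeriodicPt hA (Nat.pos_of_ne_zero hc) h

theorem typ_eq_omega_iff (hA : Function.Injective A) {x : ℕ} :
    typ A x = Nat.pair 1 0 ↔ IsOm A x := by
  unfold typ
  rw [Nat.pair_eq_pair, ind_eq_one]
  exact and_iff_left_of_imp (minimalPeriod_eq_zero_of_isOm hA)

theorem typ_eq_zeta_iff {x : ℕ} :
    typ A x = Nat.pair 0 0 ↔ ¬IsOm A x ∧ Function.minimalPeriod A x = 0 := by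
  unfold typ
  rw [Nat.pair_eq_pair, ind_eq_zero]

theorem typ_eq_iff_exists_conn (hA : Function.Injective A) {x t : ℕ} :
    typ A x = t ↔ ∃ b ∈ basesOf A t, Conn A b x := by
  constructor
  · rintro rfl
    exact ⟨base A x, ⟨base_base A x, typ_base hA x⟩, (base_spec A x).1⟩
  · rintro ⟨b, hb, hc⟩
    rw [← hb.2, hc.typ_eq hA]

theorem orbit_infinite (hA : Function.Injective A) {x : ℕ} (h : Function.minimalPeriod A x = 0) :
    (orbit A x).Infinite := by
  refine Set.infinite_of_injective_forall_mem (f := fun n => A^[n] x) ?_ fun n => ⟨n, 0, rfl⟩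
  intro m n hmn
  wlog hl : m ≤ n generalizing m n
  · exact (this hmn.symm (le_of_not_ge hl)).symm
  obtain ⟨k, rfl⟩ := Nat.exists_eq_add_of_le hl
  have := (iterate_eq_iterate_iff hA m k).1 hmn.symm
  rw [h, zero_dvd_iff] at this
  omega

theorem orbit_injOn (t : ℕ) : Set.InjOn (orbit A) (basesOf A t) := by
  intro b hb c hc hbc
  have : c ∈ orbit A b := hbc ▸ Conn.refl A c
  rw [← hb.1, ← hc.1]
  exact Conn.base_eq this

theorem omegaChains_infinite (hA : Function.Injective A)
    (h : (basesOf A (Nat.pair 1 0)).Infinite) : (omegaChains A).Infinite := by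
  refine Set.infinite_of_injOn_mapsTo (orbit_injOn _) (fun b hb => ?_) h
  have ho := (typ_eq_omega_iff hA).1 hb.2
  refine ⟨⟨b, rfl⟩, orbit_infinite hA (minimalPeriod_eq_zero_of_isOm hA ho), ?_⟩
  obtain ⟨r, hr, hr'⟩ := ho
  exact ⟨r, hr.symm, hr'⟩

theorem zetaChains_infinite (hA : Function.Injective A)
    (h : (basesOf A (Nat.pair 0 0)).Infinite) : (zetaChains A).Infinite := by
  refine Set.infinite_of_injOn_mapsTo (orbit_injOn _) (fun b hb => ?_) h
  have hz := typ_eq_zeta_iff.1 hb.2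
  refine ⟨⟨b, rfl⟩, orbit_infinite hA hz.2, fun y hy => ?_⟩
  by_contra hr
  exact hz.1 ⟨y, Conn.symm hy, hr⟩

/-! ### Orbit invariants as limits, and relative Δ⁰₂-categoricity -/

namespace Lim

theorem dec_of_dec (hK : PRClosed K) {P : ℕ → Prop} (hP : Dec K P) : Dec (Lim K) P := of_mem hK hP

theorem dec_conn (hK : PRClosed K) (hX : K X) :
    Dec (Lim K) fun p => Conn X p.unpair.1 p.unpair.2 := by
  refine (dec_exists hK (P := fun p w => X^[w.unpair.1] p.unpair.1 = X^[w.unpair.2] p.unpair.2)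
    ?_).congr fun p => ?_
  · exact hK.dec_eq
      (hK.iterate hX (hK.comp hK.left hK.right) (hK.comp hK.left hK.left))
      (hK.iterate hX (hK.comp hK.right hK.right) (hK.comp hK.right hK.left))
  · constructor
    · rintro ⟨w, hw⟩
      exact ⟨_, _, hw⟩
    · rintro ⟨m, n, hmn⟩
      exact ⟨Nat.pair m n, by simpa using hmn⟩

theorem dec_range (hK : PRClosed K) (hX : K X) : Dec (Lim K) fun x => x ∈ Set.range X :=
  dec_exists hK (P := fun x y => X y = x) (hK.dec_eq (hK.comp hX hK.right) hK.left)

theorem minimalPeriod (hK : PRClosed K) (hX : K X) : Lim K (Function.minimalPeriod X) := by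
  have hL := closed hK
  have h₁ : Dec (Lim K) fun x => ∃ n, X^[n + 1] x = x :=
    dec_exists hK (P := fun x n => X^[n + 1] x = x)
      (hK.dec_eq (hK.iterate hX (hK.comp hK.succ hK.right) hK.left) hK.left)
  have h₂ : Dec K fun p => X^[p.unpair.2] p.unpair.1 = p.unpair.1 :=
    hK.dec_eq (hK.iterate hX hK.right hK.left) hK.left
  -- The minimal period of an aperiodic point is `0` by convention. At periodic points `0` must be
  -- excluded, where it would be the least solution of `X^[p] x = x`.
  refine find hK (P := fun x p => (p = 0 ∧ ¬∃ n, X^[n + 1] x = x) ∨ (¬p = 0 ∧ X^[p] x = x))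
    ?_ ?_ ?_
  · have h₃ := hL.dec_eq hL.right hL.zero
    exact hL.dec_or (hL.dec_and h₃ (hL.dec_not (hL.dec_comp h₁ hL.left)))
      (hL.dec_and (hL.dec_not h₃) (dec_of_dec hK h₂))
  · intro x
    by_cases h : Function.minimalPeriod X x = 0
    · refine Or.inl ⟨h, fun ⟨n, hn⟩ => ?_⟩
      have : Function.IsPeriodicPt X (n + 1) x := hn
      exact (this.minimalPeriod_pos n.succ_pos).ne' h
    · exact Or.inr ⟨h, Function.iterate_minimalPeriod⟩
  · rintro x y hy (⟨rfl, h⟩ | ⟨h, h'⟩)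
    · refine h ⟨Function.minimalPeriod X x - 1, ?_⟩
      rw [Nat.sub_add_cancel hy]
      exact Function.iterate_minimalPeriod
    · exact Function.not_isPeriodicPt_of_pos_of_lt_minimalPeriod h hy h'

theorem typ (hK : PRClosed K) (hX : K X) (hO : Dec (Lim K) (IsOm X)) : Lim K (typ X) :=
  (closed hK).pair hO (minimalPeriod hK hX)

theorem base (hK : PRClosed K) (hX : K X) (hO : Dec (Lim K) (IsOm X)) : Lim K (base X) := by
  have hL := closed hK
  refine find hK (P := fun x b => Conn X b x ∧ (IsOm X x → b ∉ Set.range X)) ?_ (base_spec X)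
    fun x y hy => Nat.notMem_of_lt_sInf hy
  exact hL.dec_and (hL.dec_comp₂ (P := fun b x => Conn X b x) (dec_conn hK hX) hL.right hL.left)
    (hL.dec_imp (hL.dec_comp hO hL.left) (hL.dec_not (hL.dec_comp (dec_range hK hX) hL.right)))

theorem rank (hK : PRClosed K) (hX : K X) (hO : Dec (Lim K) (IsOm X)) : Lim K (rank X) := by
  have hL := closed hK
  have hb := base hK hX hO
  have ht := typ hK hX hO
  have h : Dec (Lim K) fun p => PunctualInj.base X p.unpair.2 = p.unpair.2 ∧
      PunctualInj.typ X p.unpair.2 = PunctualInj.typ X p.unpair.1 :=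
    hL.dec_and (hL.dec_eq (hL.comp hb hL.right) hL.right)
      (hL.dec_eq (hL.comp ht hL.right) (hL.comp ht hL.left))
  convert hL.count (P := fun b c => PunctualInj.base X c = c ∧
    PunctualInj.typ X c = PunctualInj.typ X b) h hL.id using 1
  ext n
  unfold PunctualInj.rank
  congr

/-- The isomorphism that matches canonical elements in order is a limit of functions computable
from the two structures, as soon as the union of the `ω`-chains is limit decidable. -/
theorem of_corr (hK : PRClosed K) (hA : Function.Injective A) (hB : Function.Injective B)
    (hKA : K A) (hKB : K B) (hOA : Dec (Lim K) (IsOm A)) (hOB : Dec (Lim K) (IsOm B))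
    (hE : ∀ t, Nonempty ({b // PunctualInj.base A b = b ∧ PunctualInj.typ A b = t} ≃
      {b // PunctualInj.base B b = b ∧ PunctualInj.typ B b = t}))
    {h : ℕ → ℕ} (hh : ∀ x, Corr A B x (h x)) : Lim K h := by
  have hL := closed hK
  have hbA := base hK hKA hOA
  have hbB := base hK hKB hOB
  have htA := typ hK hKA hOA
  have htB := typ hK hKB hOB
  have hrA := rank hK hKA hOA
  have hrB := rank hK hKB hOB
  have lA := of_mem hK hKA
  have lB := of_mem hK hKB
  -- `F` finds the matching canonical element, `W` the exponents that locate `x` in its orbit, and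
  -- `Y` the point of `B` located by the same exponents. Uniqueness of `Corr` identifies `Y` with
  -- `h`.
  obtain ⟨F, lF, hF⟩ := exists_find hK
    (P := fun x b' => Match A B (PunctualInj.base A x) b') (by
      have hl := hL.comp hbA hL.left
      exact hL.dec_and (hL.dec_eq (hL.comp hbA hl) hl) (hL.dec_and
        (hL.dec_eq (hL.comp hbB hL.right) hL.right) (hL.dec_and
          (hL.dec_eq (hL.comp htA hl) (hL.comp htB hL.right))
          (hL.dec_eq (hL.comp hrA hl) (hL.comp hrB hL.right))))) (exists_match hA hE)
  obtain ⟨W, lW, hW⟩ := exists_find hK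
    (P := fun x w => A^[w.unpair.1] (PunctualInj.base A x) = A^[w.unpair.2] x)
    (hL.dec_eq (hL.iterate lA (hL.comp hL.left hL.right) (hL.comp hbA hL.left))
      (hL.iterate lA (hL.comp hL.right hL.right) hL.left)) (by
      intro x
      obtain ⟨m, n, e⟩ := (base_spec A x).1
      exact ⟨Nat.pair m n, by simpa using e⟩)
  obtain ⟨Y, lY, hY⟩ := exists_find hK
    (P := fun x y => B^[(W x).unpair.1] (F x) = B^[(W x).unpair.2] y)
    (hL.dec_eq
      (hL.iterate lB (hL.comp hL.left (hL.comp lW hL.left)) (hL.comp lF hL.left))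
      (hL.iterate lB (hL.comp hL.right (hL.comp lW hL.left)) hL.right))
    fun x => (hF x).exists_iterate hA (hW x)
  have : h = Y := funext fun x => (hh x).unique hA hB ⟨F x, _, _, hF x, hW x, hY x⟩
  rwa [this]

theorem dec_exists_mem_finset (hK : PRClosed K) {P : ℕ → ℕ → Prop} (hP : ∀ r, Dec K (P r))
    (s : Finset ℕ) : Dec K fun n => ∃ r ∈ s, P r n := by
  classical
  induction s using Finset.induction_on with
  | empty => exact (hK.dec_const False).congr fun n => by simp
  | insert a s _ ih => exact (hK.dec_or (hP a) ih).congr fun n => by simp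

theorem dec_typ_eq (hK : PRClosed K) (hX : Function.Injective X) (hKX : K X) {t : ℕ}
    (hf : (basesOf X t).Finite) : Dec (Lim K) fun x => PunctualInj.typ X x = t := by
  have hL := closed hK
  refine (dec_exists_mem_finset hL (P := fun b x => Conn X b x) (fun r => ?_)
    hf.toFinset).congr fun x => ?_
  · exact hL.dec_comp₂ (P := fun b x => Conn X b x) (dec_conn hK hKX) (hL.const r) hL.id
  · rw [typ_eq_iff_exists_conn hX]
    simp

/-- With finitely many ω-chains, lying in one is a finite disjunction of connectedness statements.
With finitely many ζ-chains, it means being aperiodic and outside these. -/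
theorem dec_isOm (hK : PRClosed K) (hX : Function.Injective X) (hKX : K X)
    (hf : (basesOf X (Nat.pair 1 0)).Finite ∨ (basesOf X (Nat.pair 0 0)).Finite) :
    Dec (Lim K) (IsOm X) := by
  have hL := closed hK
  rcases hf with hf | hf
  · exact (dec_typ_eq hK hX hKX hf).congr fun x => typ_eq_omega_iff hX
  · refine (hL.dec_and (hL.dec_eq (minimalPeriod hK hKX) hL.zero)
      (hL.dec_not (dec_typ_eq hK hX hKX hf))).congr fun x => ?_
    rw [typ_eq_zeta_iff]
    have := minimalPeriod_eq_zero_of_isOm hX (x := x)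
    tauto

end Lim

/-- A computable injection structure with finitely many `ω`-chains or finitely many `ζ`-chains is
relatively `Δ⁰₂`-categorical. -/
theorem relCategorical_two (hcomp : Computable A) (hA : Function.Injective A)
    (hf : (basesOf A (Nat.pair 1 0)).Finite ∨ (basesOf A (Nat.pair 0 0)).Finite) :
    RelCategorical 2 A := by
  rintro B ⟨e, he⟩
  have hB := he.injective hA
  have hE := he.nonempty_bases_equiv hA
  have hK := RecIn.closed {(B : ℕ →. ℕ)}
  have hKA : RecIn {(B : ℕ →. ℕ)} A := (Partrec.nat_iff.1 hcomp.partrec).recursiveIn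
  have hKB : RecIn {(B : ℕ →. ℕ)} B := .oracle _ rfl
  have hfB : (basesOf B (Nat.pair 1 0)).Finite ∨ (basesOf B (Nat.pair 0 0)).Finite := by
    refine hf.imp (fun h => ?_) fun h => ?_
    · obtain ⟨e⟩ := hE (Nat.pair 1 0)
      have : Finite {b // base A b = b ∧ typ A b = Nat.pair 1 0} := h
      exact (Finite.of_equiv _ e : Finite {b // base B b = b ∧ typ B b = Nat.pair 1 0})
    · obtain ⟨e⟩ := hE (Nat.pair 0 0)
      have : Finite {b // base A b = b ∧ typ A b = Nat.pair 0 0} := h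
      exact (Finite.of_equiv _ e : Finite {b // base B b = b ∧ typ B b = Nat.pair 0 0})
  obtain ⟨h, hh, hc⟩ := exists_isIso_corr hA hB hE
  exact ⟨h, hh, (Lim.of_corr hK hA hB hKA hKB (Lim.dec_isOm hK hA hKA hf)
    (Lim.dec_isOm hK hB hKB hfB) hE hc).deltaFunIn⟩

/-! ### Stagewise recognition of finite orbits -/

theorem natPrimrec_closed : PRClosed Nat.Primrec :=
  ⟨.zero, .succ, .left, .right, .pair, .comp, .prec⟩

/-- A computable function has a primitive recursive approximation by stages. -/
theorem exists_approx {A : ℕ → ℕ} (hcomp : Computable A) :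
    ∃ (D : ℕ → ℕ → Prop) (a : ℕ → ℕ → ℕ), Dec Nat.Primrec (fun p => D p.unpair.1 p.unpair.2) ∧
      Nat.Primrec (fun p => a p.unpair.1 p.unpair.2) ∧ (∀ s x, D s x → a s x = A x) ∧
      (∀ s t x, s ≤ t → D s x → D t x) ∧ ∀ x, ∃ s, D s x := by
  have hK := natPrimrec_closed
  obtain ⟨c, hc⟩ := Nat.Partrec.Code.exists_code.1 (Partrec.nat_iff.1 hcomp.partrec)
  have he : Nat.Primrec fun p =>
      Encodable.encode (Nat.Partrec.Code.evaln p.unpair.1 c p.unpair.2) := by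
    refine Primrec.nat_iff.1 (Primrec.encode.comp (Nat.Partrec.Code.primrec_evaln.comp
      (g := fun p : ℕ => ((p.unpair.1, c), p.unpair.2)) ?_))
    exact ((Primrec.fst.comp Primrec.unpair).pair (Primrec.const c)).pair
      (Primrec.snd.comp Primrec.unpair)
  refine ⟨fun s x => ¬Encodable.encode (Nat.Partrec.Code.evaln s c x) = 0,
    fun s x => (Encodable.encode (Nat.Partrec.Code.evaln s c x)).pred,
    hK.dec_not (hK.dec_eq he hK.zero), hK.comp (hK.of_primrec Primrec.pred) he, ?_, ?_, ?_⟩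
  · intro s x h
    cases h' : Nat.Partrec.Code.evaln s c x with
    | none => simp [h'] at h
    | some y =>
      have : y ∈ Nat.Partrec.Code.eval c x := Nat.Partrec.Code.evaln_sound h'
      rw [hc] at this
      simpa [h'] using (Part.mem_some_iff.1 this)
  · intro s t x hst h
    cases h' : Nat.Partrec.Code.evaln s c x with
    | none => simp [h'] at h
    | some y =>
      have : Nat.Partrec.Code.evaln t c x = some y := Nat.Partrec.Code.evaln_mono hst h'
      simp [this]
  · intro x
    have : A x ∈ Nat.Partrec.Code.eval c x := by
      rw [hc]
      exact Part.mem_some _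
    obtain ⟨k, hk⟩ := Nat.Partrec.Code.evaln_complete.1 this
    have hk' : Nat.Partrec.Code.evaln k c x = some (A x) := hk
    exact ⟨k, by simp [hk']⟩

/-- `V a s` says that the point `a` of `A` is periodic, and that this is noticed at stage `s` for
all points of its orbit at once. -/
structure Staging (A : ℕ → ℕ) (V : ℕ → ℕ → Prop) : Prop where
  zero (a : ℕ) : ¬V a 0
  apply (a s : ℕ) : V (A a) s ↔ V a s
  unique (a s t : ℕ) : V a s → V a t → s = t
  periodic (a : ℕ) : (∃ s, V a s) ↔ 0 < Function.minimalPeriod A a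
  dec : Dec Nat.Primrec fun p => V p.unpair.1 p.unpair.2
  step : ∃ g, Nat.Primrec g ∧ ∀ a s, V a s → g (Nat.pair a s) = A a

theorem exists_staging {A : ℕ → ℕ} (hcomp : Computable A) (hA : Function.Injective A) :
    ∃ V, Staging A V := by
  classical
  have hK := natPrimrec_closed
  obtain ⟨D, g, hD, hg, hDg, hmono, hex⟩ := exists_approx hcomp
  -- By stage `s` the computation of `A` has converged along a whole period of `a` of length at most
  -- `s`. Since the whole cycle is involved, all its points satisfy this at the same stages.
  set W : ℕ → ℕ → Prop := fun a s =>
    ∃ k < s, A^[k + 1] a = a ∧ ∀ i < k + 1, D s (A^[i] a) with hW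
  -- `A` may be replaced by its stage-`s` approximation, as the two agree along converged values.
  -- The new form is primitive recursive.
  have hW' : ∀ a s, W a s ↔ ∃ k < s, (g s)^[k + 1] a = a ∧ ∀ i < k + 1, D s ((g s)^[i] a) := by
    intro a s
    refine exists_congr fun k => and_congr_right fun _ => ?_
    have key : ∀ (j : ℕ), (∀ i < j, D s (A^[i] a)) ∨ (∀ i < j, D s ((g s)^[i] a)) →
        ∀ i ≤ j, (g s)^[i] a = A^[i] a := by
      intro j h i
      induction i with
      | zero => exact fun _ => rfl
      | succ i ih =>
        intro hi
        rw [Function.iterate_succ_apply', Function.iterate_succ_apply', ih (by omega)]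
        refine hDg _ _ ?_
        rcases h with h | h
        · exact h i hi
        · rw [← ih (by omega)]
          exact h i hi
    constructor
    · rintro ⟨h₁, h₂⟩
      have := key _ (Or.inl h₂)
      refine ⟨by rw [this _ le_rfl, h₁], fun i hi => ?_⟩
      rw [this i hi.le]
      exact h₂ i hi
    · rintro ⟨h₁, h₂⟩
      have := key _ (Or.inr h₂)
      refine ⟨by rw [← this _ le_rfl, h₁], fun i hi => ?_⟩
      rw [← this i hi.le]
      exact h₂ i hi
  have decW : Dec Nat.Primrec fun p => W p.unpair.1 p.unpair.2 := by
    have hit : ∀ {c : ℕ → ℕ}, Nat.Primrec c → Nat.Primrec fun n =>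
        (g n.unpair.1.unpair.2)^[c n] n.unpair.1.unpair.1 := by
      intro c hc
      have := hK.natRec (f := fun n => n.unpair.1.unpair.1) (c := c)
        (h := fun n _ ih => g n.unpair.1.unpair.2 ih) (hK.comp hK.left hK.left)
        (by
          have := hK.comp hg (hK.pair (hK.comp hK.right (hK.comp hK.left hK.left))
            (hK.comp hK.right hK.right))
          simpa using this) hc
      convert this using 2 with n
      generalize c n = k
      induction k with
      | zero => rfl
      | succ k ih => rw [Function.iterate_succ_apply', ih]
    have h₁ : Dec Nat.Primrec fun n => ∃ k < n.unpair.2,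
        (g n.unpair.2)^[k + 1] n.unpair.1 = n.unpair.1 ∧
        ∀ i < k + 1, D n.unpair.2 ((g n.unpair.2)^[i] n.unpair.1) := by
      refine hK.dec_exists_lt (P := fun n k => (g n.unpair.2)^[k + 1] n.unpair.1 = n.unpair.1 ∧
        ∀ i < k + 1, D n.unpair.2 ((g n.unpair.2)^[i] n.unpair.1)) ?_ hK.right
      refine hK.dec_and (hK.dec_eq (hit (hK.comp hK.succ hK.right)) (hK.comp hK.left hK.left)) ?_
      refine hK.dec_forall_lt (P := fun n i => D n.unpair.1.unpair.2
        ((g n.unpair.1.unpair.2)^[i] n.unpair.1.unpair.1)) ?_ (hK.comp hK.succ hK.right)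
      refine hK.dec_comp₂ hD (hK.comp hK.right (hK.comp hK.left hK.left)) ?_
      have := hK.comp (hit hK.right) (hK.pair (hK.comp hK.left hK.left) hK.right)
      simpa using this
    exact h₁.congr fun p => (hW' _ _).symm
  have Wmono : ∀ a s t, s ≤ t → W a s → W a t := by
    rintro a s t hst ⟨k, hk, h₁, h₂⟩
    exact ⟨k, hk.trans_le hst, h₁, fun i hi => hmono _ _ _ hst (h₂ i hi)⟩
  have Wapply : ∀ a s, W (A a) s ↔ W a s := by
    intro a s
    refine exists_congr fun k => and_congr_right fun _ => ?_
    rw [← Function.iterate_succ_apply A (k + 1), Function.iterate_succ_apply', hA.eq_iff]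
    refine and_congr_right fun hp => ⟨fun h i hi => ?_, fun h i hi => ?_⟩
    · cases i with
      | zero =>
        have := h k (Nat.lt_succ_self k)
        rwa [← Function.iterate_succ_apply A k, hp] at this
      | succ i => exact h i (by omega)
    · rw [← Function.iterate_succ_apply A i]
      rcases Nat.lt_succ_iff_lt_or_eq.1 hi with hi | rfl
      · exact h (i + 1) (by omega)
      · rw [hp]
        exact h 0 (by omega)
  have hper : ∀ a, (∃ s, W a s) ↔ 0 < Function.minimalPeriod A a := by
    intro a
    constructor
    · rintro ⟨s, k, -, h, -⟩
      exact Function.IsPeriodicPt.minimalPeriod_pos k.succ_pos (f := A) h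
    · intro h
      choose σ hσ using hex
      set k := Function.minimalPeriod A a - 1
      refine ⟨(k + 1) + (Finset.range (k + 1)).sup fun i => σ (A^[i] a), k, by omega, ?_,
        fun i hi => hmono _ _ _ ?_ (hσ _)⟩
      · have : k + 1 = Function.minimalPeriod A a := by omega
        rw [this]
        exact Function.iterate_minimalPeriod
      · have := Finset.le_sup (f := fun i => σ (A^[i] a)) (Finset.mem_range.2 hi)
        omega
  -- Taking the first such stage makes it unique.
  refine ⟨fun a s => W a s ∧ ∀ t < s, ¬W a t, ?_, ?_, ?_, ?_, ?_, ?_⟩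
  · rintro a ⟨⟨k, hk, -⟩, -⟩
    omega
  · intro a s
    simp only [Wapply]
  · rintro a s t ⟨h₁, h₂⟩ ⟨h₃, h₄⟩
    by_contra hne
    rcases lt_or_gt_of_ne hne with h | h
    · exact h₄ _ h h₁
    · exact h₂ _ h h₃
  · intro a
    rw [← hper]
    exact ⟨fun ⟨s, h⟩ => ⟨s, h.1⟩, fun h => ⟨Nat.find h, Nat.find_spec h, fun t => Nat.find_min h⟩⟩
  · refine hK.dec_and decW ?_
    exact hK.dec_forall_lt (P := fun p t => ¬W p.unpair.1 t)
      (hK.dec_not (hK.dec_comp₂ decW (hK.comp hK.left hK.left) hK.right)) hK.right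
  · refine ⟨_, hK.comp hg (hK.pair hK.right hK.left), fun a s h => ?_⟩
    obtain ⟨⟨k, -, -, h⟩, -⟩ := h
    simpa using hDg _ _ (h 0 k.succ_pos)

/-! ### Punctual copies built from columns -/

section Columns

variable (A : ℕ → ℕ) (V f : ℕ → ℕ → Prop)

/-- The points of even columns that carry the finite orbits. -/
def Val (c s : ℕ) : Prop := c % 2 = 0 ∧ V (c / 2) s

/-- The points of odd columns that are put in front of the chain of their column. -/
def Fir (c s : ℕ) : Prop := c % 2 = 1 ∧ s % 2 = 1 ∧ f (c / 2) (s / 2)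

/-- The points that are put at the end of the chain of their column. -/
def Rgt (c s : ℕ) : Prop := ¬Val V c s ∧ ¬Fir f c s

open scoped Classical in
/-- The next point that is put at the end of the chain. -/
noncomputable def nextRgt (c s : ℕ) : ℕ := if Rgt V f c (s + 1) then s + 1 else s + 2

open scoped Classical in
/-- The front of the chain of column `c` before stage `s`. -/
noncomputable def front (c s : ℕ) : ℕ := Nat.rec 0 (fun y ih => if Fir f c y then y else ih) s

open scoped Classical in
/-- The structure whose finite orbits are those of `A`, and whose infinite orbits are given by one
chain in each column. The chain of an even column is an `ω`-chain, that of the column `2 * a + 1`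
grows to the left whenever `f a` holds. -/
noncomputable def colStr (x : ℕ) : ℕ :=
  if Val V x.unpair.1 x.unpair.2 then Nat.pair (2 * A (x.unpair.1 / 2)) x.unpair.2
  else if Fir f x.unpair.1 x.unpair.2 then Nat.pair x.unpair.1 (front f x.unpair.1 x.unpair.2)
  else Nat.pair x.unpair.1 (nextRgt V f x.unpair.1 x.unpair.2)

open scoped Classical in
/-- The position in the chain of the column. -/
noncomputable def pos (x : ℕ) : ℤ :=
  if Fir f x.unpair.1 x.unpair.2 then -(Nat.count (Fir f x.unpair.1) x.unpair.2 : ℤ) - 1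
  else Nat.count (Rgt V f x.unpair.1) x.unpair.2

/-- The point `x` lies on a finite orbit. -/
def IsVal (x : ℕ) : Prop := Val V x.unpair.1 x.unpair.2

end Columns

variable {A : ℕ → ℕ} {V f : ℕ → ℕ → Prop}

theorem Staging.natPrimrec_colStr (hV : Staging A V)
    (hf : Dec Nat.Primrec fun p => f p.unpair.1 p.unpair.2) : Nat.Primrec (colStr A V f) := by
  classical
  have hK := natPrimrec_closed
  have hdiv : ∀ {c : ℕ → ℕ}, Nat.Primrec c → Nat.Primrec fun n => c n / 2 :=
    fun hc => hK.comp₂ Primrec.nat_div hc (hK.const 2)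
  have hmod : ∀ {c : ℕ → ℕ} (i : ℕ), Nat.Primrec c → Dec Nat.Primrec fun n => c n % 2 = i :=
    fun i hc => hK.dec_eq (hK.comp₂ Primrec.nat_mod hc (hK.const 2)) (hK.const i)
  have hVal : Dec Nat.Primrec fun p => Val V p.unpair.1 p.unpair.2 :=
    hK.dec_and (hmod 0 hK.left) (hK.dec_comp₂ hV.dec (hdiv hK.left) hK.right)
  have hFir : Dec Nat.Primrec fun p => Fir f p.unpair.1 p.unpair.2 :=
    hK.dec_and (hmod 1 hK.left) (hK.dec_and (hmod 1 hK.right)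
      (hK.dec_comp₂ hf (hdiv hK.left) (hdiv hK.right)))
  have hRgt : Dec Nat.Primrec fun p => Rgt V f p.unpair.1 p.unpair.2 :=
    hK.dec_and (hK.dec_not hVal) (hK.dec_not hFir)
  obtain ⟨g, hg, hgA⟩ := hV.step
  have h₁ : Nat.Primrec fun x => Nat.pair (2 * g (Nat.pair (x.unpair.1 / 2) x.unpair.2))
      x.unpair.2 :=
    hK.pair (hK.comp₂ Primrec.nat_mul (hK.const 2)
      (hK.comp hg (hK.pair (hdiv hK.left) hK.right))) hK.right
  have h₂ : Nat.Primrec fun x => Nat.pair x.unpair.1 (front f x.unpair.1 x.unpair.2) := by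
    refine hK.pair hK.left ?_
    refine hK.natRec (f := fun _ => 0) (c := fun x => x.unpair.2)
      (h := fun x y ih => if Fir f x.unpair.1 y then y else ih) hK.zero ?_ hK.right
    exact hK.ind_ite (hK.dec_comp₂ hFir (hK.comp hK.left hK.left) (hK.comp hK.left hK.right))
      (hK.comp hK.left hK.right) (hK.comp hK.right hK.right)
  have h₃ : Nat.Primrec fun x => Nat.pair x.unpair.1 (nextRgt V f x.unpair.1 x.unpair.2) := by
    have hs := hK.comp hK.succ hK.right
    exact hK.pair hK.left (hK.ind_ite (hK.dec_comp₂ hRgt hK.left hs) hs (hK.comp hK.succ hs))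
  refine (hK.ind_ite hVal h₁ (hK.ind_ite hFir h₂ h₃)).of_eq fun x => ?_
  unfold colStr
  by_cases h : Val V x.unpair.1 x.unpair.2
  · rw [if_pos h, if_pos h, hgA _ _ h.2]
  · rw [if_neg h, if_neg h]

namespace Staging

variable (hV : Staging A V)
include hV

/-- A finite orbit occupies at most one height of an even column, and in odd columns only odd
heights can be put in front. So `nextRgt` never has to look beyond `s + 2`, and no unbounded search
enters the structure. -/
theorem rgt_or_rgt_succ (c s : ℕ) : Rgt V f c s ∨ Rgt V f c (s + 1) := by
  by_contra hc
  simp only [Rgt, Val, Fir] at hc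
  rcases Nat.mod_two_eq_zero_or_one c with h | h
  · have h₁ : V (c / 2) s := by
      by_contra hn
      exact hc (Or.inl ⟨fun h' => hn h'.2, by omega⟩)
    have h₂ : V (c / 2) (s + 1) := by
      by_contra hn
      exact hc (Or.inr ⟨fun h' => hn h'.2, by omega⟩)
    have := hV.unique _ _ _ h₁ h₂
    omega
  · apply hc
    rcases Nat.mod_two_eq_zero_or_one s with h' | h'
    · exact Or.inl ⟨by omega, by omega⟩
    · exact Or.inr ⟨by omega, by omega⟩

theorem rgt_zero (c : ℕ) : Rgt V f c 0 := ⟨fun h => hV.zero _ h.2, fun h => absurd h.2.1 (by simp)⟩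

theorem rgt_nextRgt (c s : ℕ) : Rgt V f c (nextRgt V f c s) := by
  unfold nextRgt
  split_ifs with h
  · exact h
  · exact (hV.rgt_or_rgt_succ c (s + 1)).resolve_left h

theorem not_val_front (c s : ℕ) : ¬Val V c (front f c s) := by
  induction s with
  | zero => exact (hV.rgt_zero (f := f) c).1
  | succ s ih =>
    unfold front
    simp only
    split_ifs with h
    · intro h'
      have := h.1
      have := h'.1
      omega
    · exact ih

/-- `front` is the last point put in front before stage `s`. Its default `0` fits, as height `0` is
never put in front and has position `0`. -/
theorem pos_front (c s : ℕ) : pos V f (Nat.pair c (front f c s)) =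
    -(open scoped Classical in Nat.count (Fir f c) s : ℤ) := by
  classical
  induction s with
  | zero => simp [pos, front, (hV.rgt_zero (f := f) c).2]
  | succ s ih =>
    rw [Nat.count_succ]
    unfold front
    simp only
    split_ifs with h
    · simp only [pos, Nat.unpair_pair, if_pos h]
      push_cast
      ring
    · exact ih

theorem pos_nextRgt {c s : ℕ} (h : Rgt V f c s) : pos V f (Nat.pair c (nextRgt V f c s)) =
    pos V f (Nat.pair c s) + 1 := by
  classical
  have h' := hV.rgt_nextRgt (f := f) c s
  simp only [pos, Nat.unpair_pair, if_neg h'.2, if_neg h.2]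
  unfold nextRgt
  split_ifs with h₁
  · rw [Nat.count_succ, if_pos h]
    push_cast
    rfl
  · rw [Nat.count_succ, Nat.count_succ, if_pos h, if_neg h₁]
    push_cast
    rfl

theorem isVal_colStr (x : ℕ) : IsVal V (colStr A V f x) ↔ IsVal V x := by
  unfold IsVal colStr
  split_ifs with h₁ h₂
  · refine iff_of_true ?_ h₁
    simp only [Nat.unpair_pair]
    refine ⟨by omega, ?_⟩
    rw [Nat.mul_div_cancel_left _ two_pos, hV.apply]
    exact h₁.2
  · refine iff_of_false ?_ h₁
    simp only [Nat.unpair_pair]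
    exact hV.not_val_front _ _
  · refine iff_of_false ?_ h₁
    simp only [Nat.unpair_pair]
    exact (hV.rgt_nextRgt _ _).1

theorem pos_colStr {x : ℕ} (hx : ¬IsVal V x) : (colStr A V f x).unpair.1 = x.unpair.1 ∧
    pos V f (colStr A V f x) = pos V f x + 1 := by
  classical
  have hx' : ¬Val V x.unpair.1 x.unpair.2 := hx
  unfold colStr
  rw [if_neg hx']
  split_ifs with h
  · refine ⟨by simp, ?_⟩
    rw [hV.pos_front]
    simp only [pos, if_pos h]
    ring
  · refine ⟨by simp, ?_⟩
    rw [hV.pos_nextRgt ⟨hx', h⟩, Nat.pair_unpair]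

-- Points put in front have negative positions and the others do not; within each of the two classes
-- the count determines the height.
omit hV in
theorem eq_of_pos_eq {x y : ℕ} (hx : ¬IsVal V x) (hy : ¬IsVal V y)
    (hc : x.unpair.1 = y.unpair.1) (hp : pos V f x = pos V f y) : x = y := by
  classical
  rw [← Nat.pair_unpair x, ← Nat.pair_unpair y, hc, Nat.pair_eq_pair]
  refine ⟨rfl, ?_⟩
  have hx' : ¬Val V x.unpair.1 x.unpair.2 := hx
  have hy' : ¬Val V y.unpair.1 y.unpair.2 := hy
  unfold pos at hp
  rw [hc] at hp hx'
  split_ifs at hp with h₁ h₂ h₂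
  · exact Nat.count_injective h₁ h₂ (by omega)
  · omega
  · omega
  · exact Nat.count_injective (p := Rgt V f y.unpair.1) ⟨hx', h₁⟩ ⟨hy', h₂⟩ (by omega)

theorem colStr_injective (hA : Function.Injective A) : Function.Injective (colStr A V f) := by
  intro x y hxy
  by_cases hx : IsVal V x
  · have hy : IsVal V y := by rwa [← hV.isVal_colStr (f := f), ← hxy, hV.isVal_colStr]
    have hx' : Val V x.unpair.1 x.unpair.2 := hx
    have hy' : Val V y.unpair.1 y.unpair.2 := hy
    unfold colStr at hxy
    rw [if_pos hx', if_pos hy', Nat.pair_eq_pair] at hxy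
    have h₁ := hA (Nat.eq_of_mul_eq_mul_left two_pos hxy.1)
    have h₂ := hx'.1
    have h₃ := hy'.1
    rw [← Nat.pair_unpair x, ← Nat.pair_unpair y, Nat.pair_eq_pair]
    exact ⟨by omega, hxy.2⟩
  · have hy : ¬IsVal V y := by rwa [← hV.isVal_colStr (f := f), ← hxy, hV.isVal_colStr]
    obtain ⟨h₁, h₂⟩ := hV.pos_colStr (f := f) hx
    obtain ⟨h₃, h₄⟩ := hV.pos_colStr (f := f) hy
    rw [hxy] at h₁ h₂
    exact eq_of_pos_eq (f := f) hx hy (h₁.symm.trans h₃) (by omega)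

theorem pos_iterate {x : ℕ} (hx : ¬IsVal V x) (n : ℕ) : ¬IsVal V ((colStr A V f)^[n] x) ∧
    ((colStr A V f)^[n] x).unpair.1 = x.unpair.1 ∧
    pos V f ((colStr A V f)^[n] x) = pos V f x + n := by
  induction n with
  | zero => exact ⟨hx, rfl, by simp⟩
  | succ n ih =>
    rw [Function.iterate_succ_apply', hV.isVal_colStr]
    obtain ⟨h₁, h₂⟩ := hV.pos_colStr (f := f) ih.1
    refine ⟨ih.1, h₁.trans ih.2.1, ?_⟩
    rw [h₂, ih.2.2]
    push_cast
    ring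

theorem iterate_eq_of_pos {x y : ℕ} {n : ℕ} (hx : ¬IsVal V x) (hy : ¬IsVal V y)
    (hc : x.unpair.1 = y.unpair.1) (hp : pos V f x + n = pos V f y) :
    (colStr A V f)^[n] x = y := by
  obtain ⟨h₁, h₂, h₃⟩ := hV.pos_iterate (f := f) hx n
  exact eq_of_pos_eq (f := f) h₁ hy (h₂.trans hc) (h₃.trans hp)

theorem isVal_iterate (x n : ℕ) : IsVal V ((colStr A V f)^[n] x) ↔ IsVal V x := by
  induction n with
  | zero => rfl
  | succ n ih => rw [Function.iterate_succ_apply', hV.isVal_colStr, ih]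

theorem isVal_iff_of_conn {x y : ℕ} (h : Conn (colStr A V f) x y) : IsVal V x ↔ IsVal V y := by
  obtain ⟨m, n, h⟩ := h
  rw [← hV.isVal_iterate (f := f) x m, h, hV.isVal_iterate]

theorem conn_iff {x y : ℕ} (hx : ¬IsVal V x) (hy : ¬IsVal V y) :
    Conn (colStr A V f) x y ↔ x.unpair.1 = y.unpair.1 := by
  constructor
  · rintro ⟨m, n, h⟩
    rw [← (hV.pos_iterate (f := f) hx m).2.1, h, (hV.pos_iterate (f := f) hy n).2.1]
  · intro h
    rcases le_total (pos V f x) (pos V f y) with hl | hl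
    · exact ⟨(pos V f y - pos V f x).toNat, 0, hV.iterate_eq_of_pos (y := y) hx hy h (by omega)⟩
    · exact ⟨0, (pos V f x - pos V f y).toNat,
        (hV.iterate_eq_of_pos (y := x) hy hx h.symm (by omega)).symm⟩

theorem minimalPeriod_of_not_isVal {x : ℕ} (hx : ¬IsVal V x) :
    Function.minimalPeriod (colStr A V f) x = 0 := by
  by_contra hc
  have h₁ := (hV.pos_iterate (f := f) hx (Function.minimalPeriod (colStr A V f) x)).2.2
  rw [Function.iterate_minimalPeriod] at h₁
  omega

/-- If infinitely many points are put in front, positions are unbounded below and every point of the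
column has a predecessor. If there are only finitely many, the last of them (or height `0`) is a
root. -/
theorem isOm_iff_of_not_isVal {x : ℕ} (hx : ¬IsVal V x) :
    IsOm (colStr A V f) x ↔ {s | Fir f x.unpair.1 s}.Finite := by
  classical
  constructor
  · rintro ⟨r, hr, hr'⟩
    by_contra hinf
    have hrv : ¬IsVal V r := by rwa [hV.isVal_iff_of_conn hr]
    have hrc := (hV.conn_iff hrv hx).1 hr
    set p := Fir f r.unpair.1 with hp
    have hinf' : (Set.ofPred p).Infinite := by
      rw [hp, hrc]
      exact hinf
    -- Counting from `0`, the `n`-th point put in front has position `-n - 1`, strictly before `r`.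
    set n := (pos V f r).natAbs with hn
    have hmem : p (Nat.nth p n) := Nat.nth_mem_of_infinite hinf' n
    have hv : ¬IsVal V (Nat.pair r.unpair.1 (Nat.nth p n)) := by
      unfold IsVal
      simp only [Nat.unpair_pair]
      intro h'
      have h₁ := h'.1
      have h₂ := hmem.1
      omega
    have hpos : pos V f (Nat.pair r.unpair.1 (Nat.nth p n)) = -(n : ℤ) - 1 := by
      unfold pos
      simp only [Nat.unpair_pair]
      rw [if_pos hmem]
      change -(Nat.count p (Nat.nth p n) : ℤ) - 1 = _
      rw [Nat.count_nth_of_infinite hinf']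
    have := hV.iterate_eq_of_pos (f := f) (n := (pos V f r + n).toNat + 1) hv hrv (by simp)
      (by rw [hpos]; push_cast; omega)
    rw [Function.iterate_succ_apply'] at this
    exact hr' ⟨_, this⟩
  · intro hfin
    obtain ⟨N, hN⟩ := hfin.bddAbove
    have hv : ¬IsVal V (Nat.pair x.unpair.1 (front f x.unpair.1 (N + 1))) := by
      unfold IsVal
      simp only [Nat.unpair_pair]
      exact hV.not_val_front _ _
    refine ⟨_, (hV.conn_iff hv hx).2 (by simp), ?_⟩
    rintro ⟨y, hy⟩
    have hyv : ¬IsVal V y := by rwa [← hV.isVal_colStr (f := f), hy]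
    obtain ⟨h₁, h₂⟩ := hV.pos_colStr (f := f) hyv
    rw [hy, hV.pos_front] at h₂
    rw [hy, Nat.unpair_pair] at h₁
    simp only at h₁
    unfold pos at h₂
    rw [← h₁] at h₂
    split_ifs at h₂ with h
    · have h₃ := Nat.count_monotone (Fir f x.unpair.1)
        (show y.unpair.2 + 1 ≤ N + 1 from Nat.succ_le_succ (hN h))
      rw [Nat.count_succ, if_pos h] at h₃
      omega
    · omega

omit hV in
theorem iterate_pair {a s : ℕ} (hV : Staging A V) (h : V a s) (n : ℕ) :
    (colStr A V f)^[n] (Nat.pair (2 * a) s) = Nat.pair (2 * A^[n] a) s ∧ V (A^[n] a) s := by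
  induction n with
  | zero => exact ⟨rfl, h⟩
  | succ n ih =>
    rw [Function.iterate_succ_apply', Function.iterate_succ_apply', ih.1, hV.apply]
    refine ⟨?_, ih.2⟩
    unfold colStr
    rw [if_pos ⟨by simp, by simpa using ih.2⟩]
    simp

omit hV in
theorem exists_eq_pair {x : ℕ} (hx : IsVal V x) : ∃ a s, V a s ∧ x = Nat.pair (2 * a) s := by
  have hx' : Val V x.unpair.1 x.unpair.2 := hx
  refine ⟨_, _, hx'.2, ?_⟩
  have := hx'.1
  rw [show 2 * (x.unpair.1 / 2) = x.unpair.1 by omega, Nat.pair_unpair]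

theorem typ_pair (hA : Function.Injective A) {a s : ℕ} (h : V a s) :
    typ (colStr A V f) (Nat.pair (2 * a) s) = typ A a := by
  have hp := (hV.periodic a).1 ⟨s, h⟩
  have hm : Function.minimalPeriod (colStr A V f) (Nat.pair (2 * a) s) =
      Function.minimalPeriod A a := by
    rw [Function.minimalPeriod_eq_minimalPeriod_iff]
    intro n
    unfold Function.IsPeriodicPt Function.IsFixedPt
    rw [(hV.iterate_pair h n).1, Nat.pair_eq_pair]
    exact ⟨fun h' => Nat.eq_of_mul_eq_mul_left two_pos h'.1, fun h' => ⟨by rw [h'], rfl⟩⟩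
  rw [typ_eq_iff]
  exact ⟨iff_of_false (not_isOm_of_isPeriodicPt (hV.colStr_injective hA) (by rwa [hm]))
    (not_isOm_of_isPeriodicPt hA hp), hm⟩

end Staging

theorem basesOf_infinite {X : ℕ → ℕ} (hX : Function.Injective X) {t : ℕ} (z : ℕ → ℕ)
    (ht : ∀ n, typ X (z n) = t) (hz : ∀ m n, Conn X (z m) (z n) → m = n) :
    (basesOf X t).Infinite := by
  refine Set.infinite_of_injective_forall_mem (f := fun n => base X (z n)) ?_
    fun n => ⟨base_base X _, (typ_base hX _).trans (ht n)⟩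
  intro m n hmn
  have h₁ := (base_spec X (z m)).1
  have h₂ := (base_spec X (z n)).1
  simp only at hmn
  rw [hmn] at h₁
  exact hz _ _ (h₁.symm.trans h₂)

theorem fir_infinite_iff {a : ℕ} : {s | Fir f (2 * a + 1) s}.Infinite ↔ {i | f a i}.Infinite := by
  have h₁ : (2 * a + 1) / 2 = a := by omega
  have : {s | Fir f (2 * a + 1) s} = (fun i => 2 * i + 1) '' {i | f a i} := by
    ext s
    simp only [Fir, Set.mem_ofPred_eq, Set.mem_image, h₁]
    constructor
    · rintro ⟨-, h, h'⟩
      exact ⟨_, h', by omega⟩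
    · rintro ⟨i, h, rfl⟩
      refine ⟨by omega, by omega, ?_⟩
      rwa [show (2 * i + 1) / 2 = i by omega]
  rw [this, Set.infinite_image_iff]
  intro i _ j _ h
  simp only at h
  omega

namespace Staging

variable (hV : Staging A V)
include hV

omit hV in
theorem not_isVal_odd (a s : ℕ) : ¬IsVal V (Nat.pair (2 * a + 1) s) := by
  intro h
  have := h.1
  rw [Nat.unpair_pair] at this
  omega

theorem typ_odd_of_infinite {a : ℕ} (h : {i | f a i}.Infinite) (s : ℕ) :
    typ (colStr A V f) (Nat.pair (2 * a + 1) s) = Nat.pair 0 0 := by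
  have hv := not_isVal_odd (V := V) a s
  rw [typ_eq_zeta_iff]
  refine ⟨?_, hV.minimalPeriod_of_not_isVal hv⟩
  rw [hV.isOm_iff_of_not_isVal hv, Nat.unpair_pair]
  exact fir_infinite_iff.2 h

theorem of_typ_zeta {x : ℕ} (hA : Function.Injective A)
    (h : typ (colStr A V f) x = Nat.pair 0 0) :
    ¬IsVal V x ∧ ∃ a, x.unpair.1 = 2 * a + 1 ∧ {i | f a i}.Infinite := by
  have hv : ¬IsVal V x := by
    intro hv
    obtain ⟨a, s, has, rfl⟩ := exists_eq_pair hv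
    rw [hV.typ_pair hA has, typ_eq_zeta_iff] at h
    exact ((hV.periodic a).1 ⟨s, has⟩).ne' h.2
  refine ⟨hv, x.unpair.1 / 2, ?_⟩
  have h₁ := (typ_eq_zeta_iff.1 h).1
  rw [hV.isOm_iff_of_not_isVal hv] at h₁
  have h₂ : x.unpair.1 = 2 * (x.unpair.1 / 2) + 1 := by
    obtain ⟨s, hs⟩ := Set.Infinite.nonempty h₁
    have := hs.1
    omega
  refine ⟨h₂, ?_⟩
  rw [h₂] at h₁
  exact fir_infinite_iff.1 h₁

/-- Both structures have countably infinitely many ω-chains and ζ-chains, so only finite orbits have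
to be compared. Those of `A` reappear under `a ↦ (2a, s)`, where `s` is the stage at which `V`
notices the orbit. -/
theorem isomorphic_colStr (hA : Function.Injective A)
    (ho : (basesOf A (Nat.pair 1 0)).Infinite) (hz : (basesOf A (Nat.pair 0 0)).Infinite)
    (hf : {a | {i | f a i}.Infinite}.Infinite) : Isomorphic A (colStr A V f) := by
  classical
  have hB := hV.colStr_injective (f := f) hA
  have inf : ∀ t, (basesOf A t).Infinite → (basesOf (colStr A V f) t).Infinite →
      Nonempty ({b // base A b = b ∧ typ A b = t} ≃
        {b // base (colStr A V f) b = b ∧ typ (colStr A V f) b = t}) := by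
    intro t h₁ h₂
    have := h₁.to_subtype
    have := h₂.to_subtype
    exact nonempty_equiv_of_countable (α := basesOf A t) (β := basesOf (colStr A V f) t)
  -- Nothing is put in front in even columns, and height `0` never carries a finite orbit.
  have ho' : (basesOf (colStr A V f) (Nat.pair 1 0)).Infinite := by
    have hv : ∀ n, ¬IsVal V (Nat.pair (2 * n) 0) := by
      intro n h
      have := h.2
      rw [Nat.unpair_pair] at this
      exact hV.zero _ this
    refine basesOf_infinite hB (fun n => Nat.pair (2 * n) 0) (fun n => ?_) fun m n h => ?_
    · rw [typ_eq_omega_iff hB, hV.isOm_iff_of_not_isVal (hv n), Nat.unpair_pair]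
      convert Set.finite_empty
      ext s
      simp [Fir]
    · rw [hV.conn_iff (hv m) (hv n), Nat.unpair_pair, Nat.unpair_pair] at h
      simpa using h
  have hz' : (basesOf (colStr A V f) (Nat.pair 0 0)).Infinite := by
    refine basesOf_infinite hB
      (fun n => Nat.pair (2 * Nat.nth (fun a => {i | f a i}.Infinite) n + 1) 0)
      (fun n => hV.typ_odd_of_infinite (Nat.nth_mem_of_infinite hf n) 0) fun m n h => ?_
    rw [hV.conn_iff (not_isVal_odd _ _) (not_isVal_odd _ _), Nat.unpair_pair,
      Nat.unpair_pair] at h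
    exact Nat.nth_injective hf (by simpa using h)
  have hE : ∀ t, Nonempty ({b // base A b = b ∧ typ A b = t} ≃
      {b // base (colStr A V f) b = b ∧ typ (colStr A V f) b = t}) := by
    intro t
    by_cases h₁ : t = Nat.pair 1 0
    · exact h₁ ▸ inf _ ho ho'
    by_cases h₂ : t = Nat.pair 0 0
    · exact h₂ ▸ inf _ hz hz'
    have hp : ∀ {X : ℕ → ℕ} {x : ℕ}, Function.Injective X → typ X x = t →
        0 < Function.minimalPeriod X x := by
      intro X x hX hx
      by_contra hc
      by_cases hO : IsOm X x
      · exact h₁ (hx.symm.trans ((typ_eq_omega_iff hX).2 hO))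
      · exact h₂ (hx.symm.trans (typ_eq_zeta_iff.2 ⟨hO, by omega⟩))
    have hst : ∀ a, ∃ s, typ A a = t → V a s := by
      intro a
      by_cases h : typ A a = t
      · obtain ⟨s, hs⟩ := (hV.periodic a).2 (hp hA h)
        exact ⟨s, fun _ => hs⟩
      · exact ⟨0, fun h' => (h h').elim⟩
    choose σ hσ using hst
    have hval : ∀ x, typ (colStr A V f) x = t → ∃ a s, V a s ∧ x = Nat.pair (2 * a) s := by
      intro x hx
      refine exists_eq_pair ?_
      by_contra hv
      exact (hp hB hx).ne' (hV.minimalPeriod_of_not_isVal hv)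
    refine nonempty_bases_equiv hA hB (fun a => Nat.pair (2 * a) (σ a)) (fun x => x.unpair.1 / 2)
      ?_ ?_ ?_ ?_ ?_ ?_
    · intro a ha
      rw [hV.typ_pair hA (hσ a ha), ha]
    · intro x hx
      obtain ⟨a, s, has, rfl⟩ := hval x hx
      rw [← hx, hV.typ_pair hA has]
      simp
    · rintro a b ha hb ⟨m, n, hmn⟩
      have h₁ := hV.iterate_pair (f := f) (hσ a ha) m
      have h₂ := hV.iterate_pair (f := f) (hσ b hb) n
      rw [hmn] at h₁
      exact ⟨m, n, by rw [h₁.1, h₂.1, hV.unique _ _ _ h₁.2 h₂.2]⟩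
    · rintro x y hx hy ⟨m, n, hmn⟩
      obtain ⟨a, s, has, rfl⟩ := hval x hx
      obtain ⟨b, s', hbs, rfl⟩ := hval y hy
      rw [(hV.iterate_pair has m).1, (hV.iterate_pair hbs n).1, Nat.pair_eq_pair] at hmn
      refine ⟨m, n, ?_⟩
      simpa using hmn.1
    · intro a _
      simpa using Conn.refl A a
    · intro x hx
      obtain ⟨a, s, has, rfl⟩ := hval x hx
      have ha : typ A a = t := by rw [← hx, hV.typ_pair hA has]
      have : σ a = s := hV.unique _ _ _ (hσ a ha) has
      simpa [this] using Conn.refl (colStr A V f) _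
  obtain ⟨h, hh, -⟩ := exists_isIso_corr hA hB hE
  exact ⟨h, hh⟩

end Staging

/-! ### Π⁰₂ statements as infinitely many events -/

section Counter

variable (T : ℕ → ℕ → ℕ → Prop)

open scoped Classical in
/-- The number of `y` for which, one after the other, a witness has been found before stage `i`. -/
noncomputable def progress (c i : ℕ) : ℕ :=
  Nat.rec 0 (fun j k => if ∃ w < j + 1, T c k w then k + 1 else k) i

/-- A new witness is found at stage `i`. -/
def Progresses (c i : ℕ) : Prop := ∃ w < i + 1, T c (progress T c i) w

open scoped Classical in
theorem progress_eq_count (c i : ℕ) : progress T c i = Nat.count (Progresses T c) i := by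
  induction i with
  | zero => rfl
  | succ i ih =>
    rw [Nat.count_succ, ← ih]
    by_cases h : Progresses T c i
    · rw [if_pos h]
      exact if_pos h
    · rw [if_neg h]
      exact if_neg h

/-- At its `y`-th success, counting from `0`, the counter stands at `y` and has found a witness for
it. Conversely, a counter stuck at some `k` would advance once the stage reaches a witness for `k`.
-/
theorem infinite_progresses_iff (c : ℕ) :
    {i | Progresses T c i}.Infinite ↔ ∀ y, ∃ w, T c y w := by
  classical
  constructor
  · intro h y
    obtain ⟨w, -, hw⟩ := Nat.nth_mem_of_infinite (p := Progresses T c) h y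
    rw [progress_eq_count, Nat.count_nth_of_infinite h] at hw
    exact ⟨w, hw⟩
  · intro h hfin
    obtain ⟨N, hN⟩ := hfin.bddAbove
    have hN' : ∀ i, N < i → ¬Progresses T c i := fun i hi h' => absurd (hN h') (not_le.2 hi)
    have hconst : ∀ k, progress T c (N + 1 + k) = progress T c (N + 1) := by
      intro k
      rw [progress_eq_count, progress_eq_count, Nat.count_add, Nat.add_eq_left,
        Nat.count_iff_forall_not]
      exact fun n _ => hN' _ (by omega)
    obtain ⟨w, hw⟩ := h (progress T c (N + 1))
    refine hN' (N + 1 + w) (by omega) ⟨w, by omega, ?_⟩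
    rwa [hconst]

theorem dec_progresses
    (hT : Dec Nat.Primrec fun p => T p.unpair.1 p.unpair.2.unpair.1 p.unpair.2.unpair.2) :
    Dec Nat.Primrec fun p => Progresses T p.unpair.1 p.unpair.2 := by
  classical
  have hK := natPrimrec_closed
  have hT' : ∀ {a b c : ℕ → ℕ}, Nat.Primrec a → Nat.Primrec b → Nat.Primrec c →
      Dec Nat.Primrec fun n => T (a n) (b n) (c n) := fun ha hb hc =>
    (hK.dec_comp hT (hK.pair ha (hK.pair hb hc))).congr fun n => by simp
  have hp : Nat.Primrec fun p => progress T p.unpair.1 p.unpair.2 := by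
    refine hK.natRec (f := fun _ => 0) (c := fun p => p.unpair.2)
      (h := fun p j k => if ∃ w < j + 1, T p.unpair.1 k w then k + 1 else k) hK.zero ?_ hK.right
    refine hK.ind_ite ?_ (hK.comp hK.succ (hK.comp hK.right hK.right)) (hK.comp hK.right hK.right)
    refine hK.dec_exists_lt (P := fun p w => T p.unpair.1.unpair.1 p.unpair.2.unpair.2 w) ?_
      (hK.comp hK.succ (hK.comp hK.left hK.right))
    exact hT' (hK.comp hK.left (hK.comp hK.left hK.left))
      (hK.comp hK.right (hK.comp hK.right hK.left)) hK.right
  refine hK.dec_exists_lt (P := fun p w => T p.unpair.1 (progress T p.unpair.1 p.unpair.2) w) ?_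
    (hK.comp hK.succ hK.right)
  exact hT' (hK.comp hK.left hK.left) (hK.comp hp hK.left) hK.right

end Counter

/-! ### Finite sequences and the Σ⁰₃ normal form -/

/-- The length of the finite sequence with code `c`. -/
def seqLen (c : ℕ) : ℕ := (Denumerable.ofNat (List ℕ) c).length

/-- The entry at `p` of the finite sequence with code `c`. -/
def seqGet (c p : ℕ) : ℕ := (Denumerable.ofNat (List ℕ) c).getD p 0

theorem natPrimrec_seqLen : Nat.Primrec seqLen :=
  Primrec.nat_iff.1 (Primrec.list_length.comp (Primrec.ofNat (List ℕ)))

theorem primrec₂_seqGet : Primrec₂ seqGet :=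
  (Primrec.list_getD 0).comp ((Primrec.ofNat (List ℕ)).comp Primrec.fst) Primrec.snd

theorem exists_seq (F : ℕ → ℕ) (N : ℕ) : ∃ c, seqLen c = N ∧ ∀ p < N, seqGet c p = F p := by
  refine ⟨Encodable.encode ((List.range N).map F), ?_, fun p hp => ?_⟩
  · simp [seqLen]
  · simp [seqGet, hp]

theorem seq_ext {c d : ℕ} (hl : seqLen c = seqLen d)
    (h : ∀ p < seqLen c, seqGet c p = seqGet d p) : c = d := by
  have : Denumerable.ofNat (List ℕ) c = Denumerable.ofNat (List ℕ) d := by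
    refine List.ext_getElem hl fun p h₁ h₂ => ?_
    have := h p h₁
    unfold seqGet at this
    rwa [List.getD_eq_getElem _ _ h₁, List.getD_eq_getElem _ _ h₂] at this
  simpa using congrArg Encodable.encode this

/-- Unfolding leaves a computable matrix `R₃`. Membership in it means that the computation of the
characteristic function of `R₃ᶜ` halts at some stage with value `0`; this stage is merged into the
innermost existential quantifier. -/
theorem sigmaIn_three_normal_form {S : Set ℕ} (hS : SigmaIn ∅ 3 S) :
    ∃ T : ℕ → ℕ → ℕ → Prop,
      Dec Nat.Primrec (fun p => T p.unpair.1 p.unpair.2.unpair.1 p.unpair.2.unpair.2) ∧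
      ∀ x, x ∈ S ↔ ∃ u, ∀ y, ∃ w, T (Nat.pair x u) y w := by
  have hK := natPrimrec_closed
  obtain ⟨R₁, ⟨R₂, ⟨R₃, h₀, h₃⟩, h₂⟩, h₁⟩ := hS
  have hχ : Computable (R₃ᶜ.indicator 1 : ℕ → ℕ) :=
    Partrec.nat_iff.2 (Nat.RecursiveIn.partrec_of_oracle (by simp) h₀)
  obtain ⟨D, g, hD, hg, hDg, -, hex⟩ := exists_approx hχ
  have hmem : ∀ q, q ∈ R₃ ↔ ∃ s, D s q ∧ g s q = 0 := by
    intro q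
    constructor
    · intro hq
      obtain ⟨s, hs⟩ := hex q
      refine ⟨s, hs, ?_⟩
      rw [hDg _ _ hs]
      simp [hq]
    · rintro ⟨s, hs, h⟩
      rw [hDg _ _ hs] at h
      by_contra hq
      simp [hq] at h
  refine ⟨fun q y w => D w.unpair.2 (Nat.pair (Nat.pair q y) w.unpair.1) ∧
    g w.unpair.2 (Nat.pair (Nat.pair q y) w.unpair.1) = 0, ?_, fun x => ?_⟩
  · have hw := hK.comp hK.right hK.right
    have hq := hK.pair (hK.pair hK.left (hK.comp hK.left hK.right)) (hK.comp hK.left hw)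
    have hs := hK.comp hK.right hw
    refine hK.dec_and (hK.dec_comp₂ hD hs hq) (hK.dec_eq ?_ hK.zero)
    simpa using hK.comp hg (hK.pair hs hq)
  · rw [h₁]
    refine exists_congr fun u => ?_
    rw [← not_iff_not, ← Set.mem_compl_iff, h₂]
    push Not
    refine exists_congr fun y => ?_
    rw [← not_iff_not, ← Set.mem_compl_iff, h₃]
    push Not
    constructor
    · rintro ⟨w, hw⟩
      obtain ⟨s, hs⟩ := (hmem _).1 hw
      exact ⟨Nat.pair w s, by simpa using hs⟩
    · rintro ⟨w, hw⟩
      exact ⟨w.unpair.1, (hmem _).2 ⟨w.unpair.2, hw⟩⟩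

/-! ### A Π⁰₂ set with exactly one code for each number -/

section Tree

variable (T : ℕ → ℕ → ℕ → Prop)

/-- The value `v` records the truth of `∀ y, ∃ w, T p y w`: it is `0` if this holds, and one more
than the least counterexample otherwise. -/
def Records (p v : ℕ) : Prop :=
  (v = 0 → ∀ y, ∃ w, T p y w) ∧
    (v ≠ 0 → (∀ w, ¬T p (v - 1) w) ∧ ∀ y < v - 1, ∃ w, T p y w)

theorem exists_records (p : ℕ) : ∃ v, Records T p v := by
  classical
  by_cases h : ∀ y, ∃ w, T p y w
  · exact ⟨0, fun _ => h, fun h' => (h' rfl).elim⟩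
  · have h' : ∃ y, ∀ w, ¬T p y w := by
      push Not at h
      exact h
    refine ⟨Nat.find h' + 1, fun h₁ => absurd h₁ (Nat.succ_ne_zero _), fun _ =>
      ⟨Nat.find_spec h', fun y hy => ?_⟩⟩
    have := Nat.find_min h' hy
    push Not at this
    exact this

/-- Storing the least counterexample instead of a bare truth value is what keeps `Records` Π⁰₂:
falsity of a Π⁰₂ statement is Σ⁰₂, but correctness of a given least counterexample is a Π⁰₁
condition together with finitely many Σ⁰₁ ones. Being least, it is still determined by `p`. -/
theorem Records.unique {p v v' : ℕ} (h : Records T p v) (h' : Records T p v') : v = v' := by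
  wlog hl : v ≤ v' generalizing v v'
  · exact (this h' h (le_of_not_ge hl)).symm
  by_contra hne
  have h₁ := h'.2 (by omega)
  by_cases hv : v = 0
  · obtain ⟨w, hw⟩ := h.1 hv (v' - 1)
    exact h₁.1 w hw
  · obtain ⟨w, hw⟩ := h₁.2 (v - 1) (by omega)
    exact (h.2 hv).1 w hw

/-- Every `i < n` is the first component of some `p < L` with entry `0`. -/
def Covers (n σ L : ℕ) : Prop := ∀ i < n, ∃ p < L, p.unpair.1 = i ∧ seqGet σ p = 0

/-- The number `c` codes `n` and the shortest sequence of recorded values that covers `n`. -/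
def IsCode (c : ℕ) : Prop :=
  (Covers c.unpair.1 c.unpair.2 (seqLen c.unpair.2) ∧
    ∀ L < seqLen c.unpair.2, ¬Covers c.unpair.1 c.unpair.2 L) ∧
  ∀ p < seqLen c.unpair.2, Records T p (seqGet c.unpair.2 p)

/-- The matrix of a `Π⁰₂` definition of `IsCode`. -/
def CodeMatrix (c y w : ℕ) : Prop :=
  (Covers c.unpair.1 c.unpair.2 (seqLen c.unpair.2) ∧
    ∀ L < seqLen c.unpair.2, ¬Covers c.unpair.1 c.unpair.2 L) ∧
  ∀ p < seqLen c.unpair.2, (seqGet c.unpair.2 p = 0 → ∃ v < w, T p y v) ∧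
    (seqGet c.unpair.2 p ≠ 0 → ¬T p (seqGet c.unpair.2 p - 1) y ∧
      (y < seqGet c.unpair.2 p - 1 → ∃ v < w, T p y v))

/-- For given `y` only the finitely many entries of the sequence ask for a witness, so a single
bound `w` serves them all. -/
theorem isCode_iff (c : ℕ) : IsCode T c ↔ ∀ y, ∃ w, CodeMatrix T c y w := by
  constructor
  · rintro ⟨h₁, h₂⟩ y
    have : ∀ p, ∃ v, (∃ v, T p y v) → T p y v := by
      intro p
      by_cases h : ∃ v, T p y v
      · obtain ⟨v, hv⟩ := h
        exact ⟨v, fun _ => hv⟩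
      · exact ⟨0, fun h' => (h h').elim⟩
    choose v hv using this
    have hle : ∀ p < seqLen c.unpair.2,
        v p < (Finset.range (seqLen c.unpair.2)).sup v + 1 := fun p hp =>
      Nat.lt_succ_of_le (Finset.le_sup (f := v) (Finset.mem_range.2 hp))
    refine ⟨(Finset.range (seqLen c.unpair.2)).sup v + 1, h₁, fun p hp => ⟨fun h₀ => ?_,
      fun h₀ => ⟨((h₂ p hp).2 h₀).1 y, fun hy => ?_⟩⟩⟩
    · exact ⟨v p, hle p hp, hv p ((h₂ p hp).1 h₀ y)⟩
    · exact ⟨v p, hle p hp, hv p (((h₂ p hp).2 h₀).2 y hy)⟩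
  · intro h
    refine ⟨(h 0).choose_spec.1, fun p hp => ⟨fun h₀ y => ?_, fun h₀ => ⟨fun y => ?_,
      fun y hy => ?_⟩⟩⟩
    · obtain ⟨w, hw⟩ := h y
      obtain ⟨v, -, hv⟩ := (hw.2 p hp).1 h₀
      exact ⟨v, hv⟩
    · obtain ⟨w, hw⟩ := h y
      exact ((hw.2 p hp).2 h₀).1
    · obtain ⟨w, hw⟩ := h y
      obtain ⟨v, -, hv⟩ := ((hw.2 p hp).2 h₀).2 hy
      exact ⟨v, hv⟩

theorem dec_codeMatrix
    (hT : Dec Nat.Primrec fun p => T p.unpair.1 p.unpair.2.unpair.1 p.unpair.2.unpair.2) :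
    Dec Nat.Primrec fun p =>
      CodeMatrix T p.unpair.1 p.unpair.2.unpair.1 p.unpair.2.unpair.2 := by
  have hK := natPrimrec_closed
  have hT' : ∀ {a b c : ℕ → ℕ}, Nat.Primrec a → Nat.Primrec b → Nat.Primrec c →
      Dec Nat.Primrec fun n => T (a n) (b n) (c n) := fun ha hb hc =>
    (hK.dec_comp hT (hK.pair ha (hK.pair hb hc))).congr fun n => by simp
  have hget : ∀ {a b : ℕ → ℕ}, Nat.Primrec a → Nat.Primrec b →
      Nat.Primrec fun n => seqGet (a n) (b n) := fun ha hb => hK.comp₂ primrec₂_seqGet ha hb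
  have hlen : ∀ {a : ℕ → ℕ}, Nat.Primrec a → Nat.Primrec fun n => seqLen (a n) :=
    fun ha => hK.comp natPrimrec_seqLen ha
  have hcov : ∀ {a b c : ℕ → ℕ}, Nat.Primrec a → Nat.Primrec b → Nat.Primrec c →
      Dec Nat.Primrec fun n => Covers (a n) (b n) (c n) := by
    intro a b c ha hb hc
    refine hK.dec_forall_lt (P := fun n i => ∃ p < c n, p.unpair.1 = i ∧ seqGet (b n) p = 0) ?_ ha
    refine hK.dec_exists_lt (P := fun q p => p.unpair.1 = q.unpair.2 ∧
      seqGet (b q.unpair.1) p = 0) ?_ (hK.comp hc hK.left)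
    exact hK.dec_and (hK.dec_eq (hK.comp hK.left hK.right) (hK.comp hK.right hK.left))
      (hK.dec_eq (hget (hK.comp hb (hK.comp hK.left hK.left)) hK.right) hK.zero)
  have hn := hK.comp hK.left hK.left
  have hσ := hK.comp hK.right hK.left
  refine hK.dec_and (hK.dec_and (hcov hn hσ (hlen hσ)) ?_) ?_
  · refine hK.dec_forall_lt (P := fun p L => ¬Covers p.unpair.1.unpair.1 p.unpair.1.unpair.2 L)
      (hK.dec_not ?_) (hlen hσ)
    exact hcov (hK.comp hn hK.left) (hK.comp hσ hK.left) hK.right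
  · refine hK.dec_forall_lt (P := fun q p =>
      (seqGet q.unpair.1.unpair.2 p = 0 → ∃ v < q.unpair.2.unpair.2, T p q.unpair.2.unpair.1 v) ∧
      (seqGet q.unpair.1.unpair.2 p ≠ 0 →
        ¬T p (seqGet q.unpair.1.unpair.2 p - 1) q.unpair.2.unpair.1 ∧
        (q.unpair.2.unpair.1 < seqGet q.unpair.1.unpair.2 p - 1 →
          ∃ v < q.unpair.2.unpair.2, T p q.unpair.2.unpair.1 v))) ?_ (hlen hσ)
    have hv := hget (hK.comp hσ hK.left) hK.right
    have hv' := hK.comp (hK.of_primrec Primrec.pred) hv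
    have hy := hK.comp (hK.comp hK.left hK.right) hK.left
    have h₀ := hK.dec_eq hv hK.zero
    have hex : Dec Nat.Primrec fun r => ∃ v < r.unpair.1.unpair.2.unpair.2,
        T r.unpair.2 r.unpair.1.unpair.2.unpair.1 v := by
      refine hK.dec_exists_lt (P := fun r v => T r.unpair.2 r.unpair.1.unpair.2.unpair.1 v) ?_
        (hK.comp (hK.comp hK.right hK.right) hK.left)
      exact hT' (hK.comp hK.right hK.left) (hK.comp hy hK.left) hK.right
    refine hK.dec_and (hK.dec_imp h₀ hex) (hK.dec_imp (hK.dec_not h₀) (hK.dec_and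
      (hK.dec_not (hT' hK.right hv' hy)) (hK.dec_imp ?_ hex)))
    exact hK.dec_primrecRel Primrec.nat_lt hy hv'

/-- Correct records agree on their common length, and then minimality of the covering length forces
the lengths to be equal. -/
theorem IsCode.eq_of_fst_eq {c d : ℕ} (hc : IsCode T c) (hd : IsCode T d)
    (h : c.unpair.1 = d.unpair.1) : c = d := by
  wlog hl : seqLen c.unpair.2 ≤ seqLen d.unpair.2 generalizing c d
  · exact (this hd hc h.symm (le_of_not_ge hl)).symm
  have hget : ∀ p < seqLen c.unpair.2, seqGet c.unpair.2 p = seqGet d.unpair.2 p :=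
    fun p hp => (hc.2 p hp).unique T (hd.2 p (hp.trans_le hl))
  have hlen : seqLen c.unpair.2 = seqLen d.unpair.2 := by
    by_contra hne
    refine hd.1.2 _ (lt_of_le_of_ne hl hne) ?_
    rw [← h]
    intro i hi
    obtain ⟨p, hp, h₁, h₂⟩ := hc.1.1 i hi
    exact ⟨p, hp, h₁, by rw [← hget p hp, h₂]⟩
  rw [← Nat.pair_unpair c, ← Nat.pair_unpair d, h, seq_ext hlen hget]

theorem exists_isCode (hT : ∀ i, ∃ p : ℕ, p.unpair.1 = i ∧ ∀ y, ∃ w, T p y w) (n : ℕ) :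
    ∃ c, IsCode T c ∧ c.unpair.1 = n := by
  classical
  choose F hF using exists_records T
  choose P hP using hT
  have hF0 : ∀ i, F (P i) = 0 := fun i =>
    (hF (P i)).unique T ⟨fun _ => (hP i).2, fun h => (h rfl).elim⟩
  have hex : ∃ L, ∀ i < n, ∃ p < L, p.unpair.1 = i ∧ F p = 0 :=
    ⟨(Finset.range n).sup P + 1, fun i hi => ⟨P i,
      Nat.lt_succ_of_le (Finset.le_sup (Finset.mem_range.2 hi)), (hP i).1, hF0 i⟩⟩
  obtain ⟨σ, h₁, h₂⟩ := exists_seq F (Nat.find hex)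
  refine ⟨Nat.pair n σ, ⟨⟨?_, ?_⟩, ?_⟩, by simp⟩ <;> simp only [Nat.unpair_pair, h₁]
  · intro i hi
    obtain ⟨p, hp, h₃, h₄⟩ := Nat.find_spec hex i hi
    exact ⟨p, hp, h₃, by rw [h₂ p hp, h₄]⟩
  · intro L hL hc
    refine Nat.find_min hex hL fun i hi => ?_
    obtain ⟨p, hp, h₃, h₄⟩ := hc i hi
    exact ⟨p, hp, h₃, by rw [← h₂ p (hp.trans hL), h₄]⟩
  · intro p hp
    rw [h₂ p hp]
    exact hF p

theorem infinite_isCode (hT : ∀ i, ∃ p : ℕ, p.unpair.1 = i ∧ ∀ y, ∃ w, T p y w) :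
    {c | IsCode T c}.Infinite := by
  choose c hc using exists_isCode T hT
  refine Set.infinite_of_injective_forall_mem (f := c) (fun m n hmn => ?_) fun n => (hc n).1
  rw [← (hc m).2, hmn, (hc n).2]

end Tree

/-! ### Decoding, and the two inclusions -/

/-- The index with first component `n` and entry `0` in the sequence coded by `c`. -/
noncomputable def zeroIndex (n c : ℕ) : ℕ :=
  bfind (fun p => p.unpair.1 = n ∧ seqGet c.unpair.2 p = 0) (seqLen c.unpair.2)

theorem natPrimrec_zeroIndex : Nat.Primrec fun q => zeroIndex q.unpair.1 q.unpair.2 := by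
  have hK := natPrimrec_closed
  have hσ := hK.comp hK.right hK.right
  refine hK.bfind (P := fun q p => p.unpair.1 = q.unpair.1 ∧ seqGet q.unpair.2.unpair.2 p = 0) ?_
    (hK.comp natPrimrec_seqLen hσ)
  exact hK.dec_and (hK.dec_eq (hK.comp hK.left hK.right) (hK.comp hK.left hK.left))
    (hK.dec_eq (hK.comp₂ primrec₂_seqGet (hK.comp hσ hK.left) hK.right) hK.zero)

/-- A failed search returns its bound, so a result below the bound certifies success. -/
theorem zeroIndex_spec {n c : ℕ} (h : zeroIndex n c < seqLen c.unpair.2) :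
    (zeroIndex n c).unpair.1 = n ∧ seqGet c.unpair.2 (zeroIndex n c) = 0 := by
  classical
  by_cases hex : ∃ p, p < seqLen c.unpair.2 ∧ p.unpair.1 = n ∧ seqGet c.unpair.2 p = 0
  · have : zeroIndex n c = Nat.find hex := bfind_eq (Nat.find_spec hex).1 (Nat.find_spec hex).2
      fun j hj hj' => Nat.find_min hex hj ⟨hj.trans (Nat.find_spec hex).1, hj'⟩
    rw [this]
    exact (Nat.find_spec hex).2
  · refine absurd h (not_lt.2 (bfind_of_not fun j hj hj' => hex ⟨j, hj, hj'⟩).ge)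

theorem IsCode.zeroIndex_lt {T : ℕ → ℕ → ℕ → Prop} {n c : ℕ} (hc : IsCode T c)
    (h : n < c.unpair.1) : zeroIndex n c < seqLen c.unpair.2 := by
  classical
  have hex := hc.1.1 n h
  have : zeroIndex n c = Nat.find hex := bfind_eq (Nat.find_spec hex).1 (Nat.find_spec hex).2
    fun j hj hj' => Nat.find_min hex hj ⟨hj.trans (Nat.find_spec hex).1, hj'⟩
  rw [this]
  exact (Nat.find_spec hex).1

theorem exists_gt_of_injOn {n : ℕ} {φ : ℕ → ℕ} (h : Set.InjOn φ (Set.Iio (n + 2))) :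
    ∃ j < n + 2, n < φ j := by
  by_contra hc
  push Not at hc
  have := Finset.card_le_card_of_injOn (s := Finset.range (n + 2)) (t := Finset.range (n + 1)) φ
    (fun j hj => by
      have := hc j (by simpa using hj)
      simpa using Nat.lt_succ_of_le this) (by simpa using h)
  simp at this

variable {A : ℕ → ℕ}

/-- Degrees in the categoricity spectrum bound all `Δ⁰₃` functions. -/
theorem prcat_subset_cone (hcomp : Computable A) (hA : Function.Injective A)
    (ho : (basesOf A (Nat.pair 1 0)).Infinite) (hz : (basesOf A (Nat.pair 0 0)).Infinite) :
    prcat A ⊆ cone 3 := by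
  classical
  intro d
  induction d using Quotient.ind with | _ D
  intro hd g hg
  change PRIn D g
  have hK := natPrimrec_closed
  obtain ⟨T, decT, hT⟩ := sigmaIn_three_normal_form hg.1
  -- An index `p` is a triple `(i, v, u)`, and its Π⁰₂ statement says that `u` witnesses the Σ⁰₃
  -- fact `g i = v`.
  set T₀ : ℕ → ℕ → ℕ → Prop := fun p =>
    T (Nat.pair (Nat.pair p.unpair.1 p.unpair.2.unpair.1) p.unpair.2.unpair.2) with hT₀
  have decT₀ : Dec Nat.Primrec fun p => T₀ p.unpair.1 p.unpair.2.unpair.1 p.unpair.2.unpair.2 := by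
    have hr := hK.comp hK.right hK.left
    refine (hK.dec_comp decT (hK.pair (hK.pair (hK.pair (hK.comp hK.left hK.left)
      (hK.comp hK.left hr)) (hK.comp hK.right hr)) hK.right)).congr fun p => ?_
    simp [hT₀]
  have val : ∀ p, (∀ y, ∃ w, T₀ p y w) → g p.unpair.1 = p.unpair.2.unpair.1 := by
    intro p hp
    have := (hT (Nat.pair p.unpair.1 p.unpair.2.unpair.1)).2 ⟨_, hp⟩
    simpa using this
  have hex : ∀ i, ∃ p : ℕ, p.unpair.1 = i ∧ ∀ y, ∃ w, T₀ p y w := by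
    intro i
    obtain ⟨u, hu⟩ := (hT (Nat.pair i (g i))).1 (by simp)
    exact ⟨Nat.pair i (Nat.pair (g i) u), by simp, by simpa [hT₀] using hu⟩
  set M := CodeMatrix T₀
  have hinf : ∀ c, {i | Progresses M c i}.Infinite ↔ IsCode T₀ c := fun c =>
    (infinite_progresses_iff M c).trans (isCode_iff T₀ c).symm
  obtain ⟨V, hV⟩ := exists_staging hcomp hA
  -- In the first copy every odd column is a ζ-chain, in the second only those indexed by codes.
  -- Passing from the first to the second uses the inverse of `h₁` and then `h₂`, so both directions
  -- of reducibility in `prcat` are needed.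
  obtain ⟨h₁, i₁, -, r₁⟩ := hd (colStr A V fun _ _ => True)
    (hV.natPrimrec_colStr (hK.dec_const True))
    (hV.isomorphic_colStr hA ho hz (by simp [Set.infinite_univ]))
  obtain ⟨h₂, i₂, r₂, -⟩ := hd (colStr A V (Progresses M))
    (hV.natPrimrec_colStr (dec_progresses M (dec_codeMatrix T₀ decT₀)))
    (hV.isomorphic_colStr hA ho hz (by
      simp only [hinf]
      exact infinite_isCode T₀ hex))
  change PRIn D h₁.symm at r₁
  change PRIn D h₂ at r₂
  have hφ := i₁.symm.trans i₂
  have hB := hV.colStr_injective (f := fun _ _ => True) hA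
  set x : ℕ → ℕ := fun j => Nat.pair (2 * j + 1) 0
  set φ : ℕ → ℕ := fun j => (h₂ (h₁.symm (x j))).unpair.1 / 2 with hφdef
  have key : ∀ j, ¬IsVal V (h₂ (h₁.symm (x j))) ∧
      (h₂ (h₁.symm (x j))).unpair.1 = 2 * φ j + 1 ∧ IsCode T₀ (φ j) := by
    intro j
    have ht : typ (colStr A V (Progresses M)) (h₂ (h₁.symm (x j))) = Nat.pair 0 0 :=
      hφ.typ_eq.trans (hV.typ_odd_of_infinite (by simpa using Set.infinite_univ (α := ℕ)) 0)
    obtain ⟨h₁, a, h₂, h₃⟩ := hV.of_typ_zeta hA ht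
    have : φ j = a := by
      simp only [hφdef, h₂]
      omega
    rw [this]
    exact ⟨h₁, h₂, (hinf a).1 h₃⟩
  have φinj : Function.Injective φ := by
    intro j k hjk
    have hc : Conn (colStr A V (Progresses M)) (h₂ (h₁.symm (x j))) (h₂ (h₁.symm (x k))) := by
      rw [hV.conn_iff (key j).1 (key k).1, (key j).2.1, (key k).2.1, hjk]
    have hc' : Conn (colStr A V fun _ _ => True) (x j) (x k) := hφ.conn_iff.1 hc
    rw [hV.conn_iff (Staging.not_isVal_odd _ _) (Staging.not_isVal_odd _ _)] at hc'
    simpa [x] using hc'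
  -- The codes `φ 0, …, φ (n + 1)` have distinct first components, and only `n + 1` numbers are at
  -- most `n`. A code whose first component exceeds `n` has an entry `0` at some index for `n`.
  have found : ∀ n, ∃ j < n + 2, zeroIndex n (φ j) < seqLen (φ j).unpair.2 := by
    intro n
    obtain ⟨j, hj, hn⟩ := exists_gt_of_injOn (n := n) (φ := fun j => (φ j).unpair.1)
      fun j _ k _ h => φinj ((key j).2.2.eq_of_fst_eq T₀ (key k).2.2 h)
    exact ⟨j, hj, (key j).2.2.zeroIndex_lt hn⟩
  set J : ℕ → ℕ := fun n => bfind (fun j => zeroIndex n (φ j) < seqLen (φ j).unpair.2) (n + 2)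
  have hJ : ∀ n, zeroIndex n (φ (J n)) < seqLen (φ (J n)).unpair.2 := by
    intro n
    have : J n = Nat.find (found n) := bfind_eq (Nat.find_spec (found n)).1
      (Nat.find_spec (found n)).2
      fun j hj hj' => Nat.find_min (found n) hj ⟨hj.trans (Nat.find_spec (found n)).1, hj'⟩
    rw [this]
    exact (Nat.find_spec (found n)).2
  -- Every code records correctly, so an entry `0` yields the true value of `g n`, whichever code it
  -- comes from.
  have hg' : g = fun n => (zeroIndex n (φ (J n))).unpair.2.unpair.1 := by
    ext n
    obtain ⟨h₁, h₂⟩ := zeroIndex_spec (hJ n)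
    have := val _ (((key (J n)).2.2.2 _ (hJ n)).1 h₂)
    rwa [h₁] at this
  have hD := PRIn.closed D
  have φmem : PRIn D φ := by
    refine hD.comp₂ Primrec.nat_div (hD.comp hD.left (hD.comp r₂ (hD.comp r₁ (hD.pair ?_ hD.zero))))
      (hD.const 2)
    exact hD.of_primrec (Primrec.succ.comp (Primrec.nat_mul.comp (Primrec.const 2) Primrec.id))
  have zmem : ∀ {a b : ℕ → ℕ}, PRIn D a → PRIn D b → PRIn D fun n => zeroIndex (a n) (b n) :=
    fun ha hb => by
      simpa using hD.comp (hD.of_natPrimrec natPrimrec_zeroIndex) (hD.pair ha hb)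
  have Jmem : PRIn D J := by
    refine hD.bfind (P := fun n j => zeroIndex n (φ j) < seqLen (φ j).unpair.2) ?_
      (hD.comp hD.succ hD.succ)
    have hφ' := hD.comp φmem hD.right
    exact hD.dec_primrecRel Primrec.nat_lt (zmem hD.left hφ')
      (hD.comp (hD.of_natPrimrec natPrimrec_seqLen) (hD.comp hD.right hφ'))
  rw [hg']
  exact hD.comp hD.left (hD.comp hD.right (zmem hD.id (hD.comp φmem Jmem)))

theorem SigmaIn.of_primrec_oracle {B : ℕ → ℕ} (hB : Nat.Primrec B) :
    ∀ {n : ℕ} {S : Set ℕ}, SigmaIn {(B : ℕ →. ℕ)} n S → SigmaIn ∅ n S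
  | 0, S, h => Nat.RecursiveIn.subst h fun g hg => by
      rw [Set.mem_singleton_iff.1 hg]
      exact hB.recursiveIn
  | n + 1, S, ⟨R, hR, h⟩ => ⟨R, SigmaIn.of_primrec_oracle hB hR, h⟩

theorem SigmaIn.preimage {O : Set (ℕ →. ℕ)} :
    ∀ {n : ℕ} {S : Set ℕ} {f : ℕ → ℕ}, Nat.Primrec f → SigmaIn O n S → SigmaIn O n (f ⁻¹' S)
  | 0, S, f, hf, h => by
      have hS : RecIn O (S.indicator 1) := h
      exact (RecIn.closed O).comp (f := S.indicator 1) hS ((RecIn.closed O).of_natPrimrec hf)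
  | n + 1, S, f, hf, ⟨R, hR, h⟩ => by
      have hK := natPrimrec_closed
      refine ⟨(fun p => Nat.pair (f p.unpair.1) p.unpair.2) ⁻¹' R,
        SigmaIn.preimage (hK.pair (hK.comp hf hK.left) hK.right) hR, fun x => ?_⟩
      rw [Set.mem_preimage, h]
      simp

/-- The graph of the inverse is the graph with its coordinates exchanged, a primitive recursive
preimage. -/
theorem DeltaFunIn.symm {O : Set (ℕ →. ℕ)} {n : ℕ} {h : ℕ ≃ ℕ} (hh : DeltaFunIn O n h) :
    DeltaFunIn O n h.symm := by
  have hK := natPrimrec_closed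
  have hs : Nat.Primrec fun p => Nat.pair p.unpair.2 p.unpair.1 := hK.pair hK.right hK.left
  have he : {p : ℕ | h.symm p.unpair.1 = p.unpair.2} =
      (fun p => Nat.pair p.unpair.2 p.unpair.1) ⁻¹' {p | h p.unpair.1 = p.unpair.2} := by
    ext p
    simp only [Set.mem_ofPred_eq, Set.mem_preimage, Nat.unpair_pair]
    rw [Equiv.symm_apply_eq, eq_comm]
  unfold DeltaFunIn
  rw [he]
  exact ⟨hh.1.preimage hs, hh.2.preimage hs⟩

/-- A primitive recursive oracle `B` can be removed from the definition of a relatively Δ⁰ₙ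
isomorphism, so a degree in the cone bounds this isomorphism and its inverse. -/
theorem cone_subset_prcat {n : ℕ} (hcat : RelCategorical n A) : cone n ⊆ prcat A := by
  intro d hd B hB hAB
  obtain ⟨h, hh, hΔ⟩ := hcat B hAB
  have hΔ' : DeltaFunIn ∅ n h :=
    ⟨hΔ.1.of_primrec_oracle hB, hΔ.2.of_primrec_oracle hB⟩
  exact ⟨h, hh, hd h hΔ', hd h.symm hΔ'.symm⟩

end PunctualInj

theorem theorem2p4 (A : ℕ → ℕ) (hcomp : Computable A) (hinj : Function.Injective A)
    (hcat : PunctualInj.RelCategorical 3 A) (hncat : ¬ PunctualInj.RelCategorical 2 A) :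
    ((PunctualInj.omegaChains A).Infinite ∧ (PunctualInj.zetaChains A).Infinite) ∧
      PunctualInj.prcat A = PunctualInj.cone 3 := by
  have ho : (PunctualInj.basesOf A (Nat.pair 1 0)).Infinite := fun h =>
    hncat (PunctualInj.relCategorical_two hcomp hinj (Or.inl h))
  have hz : (PunctualInj.basesOf A (Nat.pair 0 0)).Infinite := fun h =>
    hncat (PunctualInj.relCategorical_two hcomp hinj (Or.inr h))
  exact ⟨⟨PunctualInj.omegaChains_infinite hinj ho, PunctualInj.zetaChains_infinite hinj hz⟩,
    (PunctualInj.prcat_subset_cone hcomp hinj ho hz).antisymm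
      (PunctualInj.cone_subset_prcat hcat)⟩
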